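/- Consider the Hunter--Saxton equation $$\partial_t u+\partial_x\Big[\tfrac12u^2\Big]=\tfrac12\int_{-\infty}^x w^2(y,t)\,dy,\qquad w=\partial_xu,\qquad u(x,0)=u_0(x),\quad w_0=u_0'. \tag{HS}$$ A \emph{weak solution} is a continuous function $u$ on $\mathbb R\times[0,\infty)$ such that $u(\cdot,t)$ is absolutely continuous for each $t\ge0$, $w\in L^\infty([0,\infty);L^2(\mathbb R))$, the map $t\mapsto u(\cdot,t)\in L^2_{loc}(\mathbb R)$ is absolutely continuous on bounded time intervals, (HS) holds in the sense of distributions, $u(\cdot,0)=u_0$ and $w_0\in L^2(\mathbb R)$. A \emph{characteristic} of $u$ on $[0,T]$ emanating from $x_0$ is a Lipschitz function $x:[0,T]\to\mathbb R$ with $x(0)=x_0$ and $\dot x(s)=u(x(s),s)$ for a.e. $s\in[0,T]$. It is the \emph{rightmost} (\emph{leftmost}) one if $y\le x$ (resp. $y\ge x$) on $[0,T]$ for every characteristic $y$ on $[0,T]$ emanating from $x_0$. Let $I_\infty$ be the set of $\zeta\in\mathbb R$ at which $u_0$ is differentiable with $w_0(\zeta)\ge0$, and let $I_\infty^{unique}$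 be the set of $\zeta\in I_\infty$ such that, for every $T\ge0$, any two characteristics on $[0,T]$ emanating from $\zeta$ coincide. Put $w_+=\max\{w,0\}$ and $$E^+_{[\eta,\xi]}(t)=\int_{[\eta,\xi]}w_+^2(y,t)\,dy,$$ where $[\eta,\xi]=\emptyset$, and hence $E^+_{[\eta,\xi]}(t)=0$, if $\xi<\eta$. Let $u$ be any weak solution of (HS). Then: 1. Let $a,b\in I_\infty^{unique}$ with $a<b$ and let $t\in[0,\infty)$. Characteristics $x_a$, $x_b$ on $[0,t]$ emanating from $a$ and $b$ exist (and are unique), and $$E^+_{[x_a(t),x_b(t)]}(t)\ \ge\ E^+_{[a,b]}(0).$$ 2. Let $a,b\in\mathbb R$ be arbitrary with $a<b$ and let $t\in[0,\infty)$. The rightmost characteristic $x_r[a]$ on $[0,t]$ emanating from $a$ and the leftmost characteristic $x_l[b]$ on $[0,t]$ emanating from $b$ exist, and $$E^+_{[x_r[a](t),x_l[b](t)]}(t)\ \ge\ E^+_{[a,b]}(0).$$ -/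

import Mathlib

open MeasureTheory Set
open scoped NNReal ENNReal

noncomputable section

namespace HunterSaxton

/-- The spatial derivative `w = ∂ₓu`, for `u` written as a function of `(x, t)`. For `u(·, t)`
absolutely continuous it is the almost everywhere defined derivative (its value where `u(·, t)`
is not differentiable is immaterial). -/
def w (u : ℝ → ℝ → ℝ) (x t : ℝ) : ℝ := deriv (fun y => u y t) x

/-- The right-hand side `½ ∫_{-∞}^x w(y, t)² dy` of the Hunter-Saxton equation. -/
def source (u : ℝ → ℝ → ℝ) (x t : ℝ) : ℝ := (1 / 2) * ∫ y in Iic x, (w u y t) ^ 2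

/-- The equation `∂ₜu + ∂ₓ(u²/2) = ½ ∫_{-∞}^x w² dy` in the sense of distributions, tested with
smooth functions `φ(x, t)` compactly supported in the open half-plane `t > 0`. -/
def SolvesInDistributions (u : ℝ → ℝ → ℝ) : Prop :=
  ∀ φ : ℝ × ℝ → ℝ, ContDiff ℝ ((⊤ : ℕ∞) : WithTop ℕ∞) φ → HasCompactSupport φ →
    tsupport φ ⊆ {z : ℝ × ℝ | 0 < z.2} →
    ∫ z in {z : ℝ × ℝ | 0 < z.2},
      (u z.1 z.2 * fderiv ℝ φ z (0, 1) + (1 / 2) * (u z.1 z.2) ^ 2 * fderiv ℝ φ z (1, 0)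
        + source u z.1 z.2 * φ z) = 0

/-- Weak solutions of the Hunter-Saxton equation with initial datum `u₀`; only the values of `u`
at times `t ≥ 0` are used. -/
structure IsWeakSolution (u₀ : ℝ → ℝ) (u : ℝ → ℝ → ℝ) : Prop where
  /-- `u` is continuous on `ℝ × [0, ∞)`. -/
  continuousOn : ContinuousOn (fun z : ℝ × ℝ => u z.1 z.2) {z : ℝ × ℝ | 0 ≤ z.2}
  /-- For each `t ≥ 0`, `u(·, t)` is absolutely continuous. -/
  absolutelyContinuous : ∀ t : ℝ, 0 ≤ t → ∀ a b : ℝ,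
    AbsolutelyContinuousOnInterval (fun x => u x t) a b
  /-- `w ∈ L^∞([0, ∞); L²(ℝ))`. -/
  bounded : ∃ C : ℝ≥0, ∀ᵐ t ∂(volume.restrict (Ici (0 : ℝ))),
    eLpNorm (fun x => w u x t) 2 volume ≤ C
  /-- `t ↦ u(·, t)` is absolutely continuous on bounded time intervals with values in `L²_loc`,
  that is, with values in `L²(-R, R)` for every `R`. -/
  absolutelyContinuous_time : ∀ R : ℝ, 0 < R → ∀ T : ℝ, 0 < T →
    ∃ U : ℝ → Lp ℝ 2 (volume.restrict (Icc (-R) R)),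
      (∀ t ∈ Icc 0 T, (U t : ℝ → ℝ) =ᵐ[volume.restrict (Icc (-R) R)] fun x => u x t) ∧
      AbsolutelyContinuousOnInterval U 0 T
  /-- The equation holds in the sense of distributions. -/
  equation : SolvesInDistributions u
  /-- The initial condition. -/
  initial : ∀ x : ℝ, u x 0 = u₀ x
  /-- The initial energy is finite. -/
  initial_memLp : MemLp (deriv u₀) 2 volume

/-- `x` is a characteristic of `u` on `[0, T]` emanating from `x₀`: a Lipschitz function on
`[0, T]` with `x(0) = x₀` and `x'(s) = u(x(s), s)` for almost every `s ∈ [0, T]`. -/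
structure IsCharacteristic (u : ℝ → ℝ → ℝ) (T x₀ : ℝ) (x : ℝ → ℝ) : Prop where
  initial : x 0 = x₀
  lipschitz : ∃ K : ℝ≥0, LipschitzOnWith K x (Icc 0 T)
  hasDerivAt : ∀ᵐ s ∂(volume.restrict (Icc 0 T)), HasDerivAt x (u (x s) s) s

/-- `x` is the rightmost characteristic on `[0, T]` emanating from `x₀`. -/
def IsRightmostCharacteristic (u : ℝ → ℝ → ℝ) (T x₀ : ℝ) (x : ℝ → ℝ) : Prop :=
  IsCharacteristic u T x₀ x ∧
    ∀ y : ℝ → ℝ, IsCharacteristic u T x₀ y → ∀ s ∈ Icc 0 T, y s ≤ x s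

/-- `x` is the leftmost characteristic on `[0, T]` emanating from `x₀`. -/
def IsLeftmostCharacteristic (u : ℝ → ℝ → ℝ) (T x₀ : ℝ) (x : ℝ → ℝ) : Prop :=
  IsCharacteristic u T x₀ x ∧
    ∀ y : ℝ → ℝ, IsCharacteristic u T x₀ y → ∀ s ∈ Icc 0 T, x s ≤ y s

/-- The set `I_∞` of points where `u₀` is differentiable with `w₀ = u₀' ≥ 0`. -/
def IInfty (u₀ : ℝ → ℝ) : Set ℝ := {ζ | DifferentiableAt ℝ u₀ ζ ∧ 0 ≤ deriv u₀ ζ}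

/-- The set `I_∞^unique` of the points of `I_∞` from which the characteristic never branches:
any two characteristics emanating from the point coincide as long as they are defined. -/
def IInftyUnique (u₀ : ℝ → ℝ) (u : ℝ → ℝ → ℝ) : Set ℝ :=
  {ζ | ζ ∈ IInfty u₀ ∧ ∀ T : ℝ, 0 ≤ T → ∀ x y : ℝ → ℝ,
    IsCharacteristic u T ζ x → IsCharacteristic u T ζ y → EqOn x y (Icc 0 T)}

/-- The positive part `∫_{[η, ξ]} w₊(y, t)² dy` of the energy in `[η, ξ]` at time `t`, as an
extended nonnegative number. The interval `[η, ξ]` is empty if `ξ < η`. -/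
def positiveEnergy (u : ℝ → ℝ → ℝ) (η ξ t : ℝ) : ℝ≥0∞ :=
  ∫⁻ y in Icc η ξ, ENNReal.ofReal ((max (w u y t) 0) ^ 2)

end HunterSaxton

end

/-! Let `x₁`, `x₂` be characteristics with `x₁(0) < x₂(0)`, and let `H` be their distance and `p`
the difference of their velocities. Then `H' = p`. Formally the velocity of a characteristic grows
at the rate given by the source, so `p' = ½ ∫ w²` over the interval between them, and Cauchy-Schwarz
gives `2 H p' ≥ p²`. If `p(0) > 0`, then `p` and `H` stay positive and `(p²/H)' = p (2 H p' - p²)/H²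
≥ 0`. A second use of Cauchy-Schwarz, at time `t`, bounds `p²/H` by the positive energy between the
curves (`EnergyFlow.separation_growth`, `ofReal_sq_sub_div_le_lintegral`).

Hence every cell `[c, d]` with `u₀(c) < u₀(d)` contributes at most the positive energy at time `t`
between the rightmost curve from `c` and the leftmost curve from `d`. Adjacent cells yield intervals
overlapping in at most a point, because the leftmost curve from a common endpoint lies weakly to the
left of the rightmost one. Summing over finer and finer uniform partitions and applying Fatou's
lemma to the squared positive difference quotients gives the inequality on `[a, b]`
(`lintegral_sq_deriv_le_of_superadditive`). No structure of the flow map is needed.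

Two points need care for a weak solution. The velocity law along a given characteristic
(`EnergyFlow.velocity_along`) comes from the balance of `u` in a strip of width `ε` to the right of
the curve: the quadratic flux error, divided by `ε`, is at most an increment of the source over the
strip, which tends to `0`. Extremal characteristics (`exists_maximal_integral_curve`) exist although
`u` is only Hölder-1/2 in `x`: they are limits of solutions for Lipschitz fields lying strictly
above `u`. -/

namespace HunterSaxton
open Filter Topology

/-! ### Continuous extension of the solution and a bounded source -/

/-- The data of a weak solution extended continuously to all times, with a source that is bounded
everywhere. -/
structure EnergyFlow (v F : ℝ → ℝ → ℝ) (M : ℝ) : Prop where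
  continuous : Continuous (Function.uncurry v)
  measurable : Measurable (Function.uncurry F)
  nonneg : ∀ x s, 0 ≤ F x s
  le : ∀ x s, F x s ≤ M
  mono : ∀ s, Monotone fun x => F x s
  continuous_source : ∀ s, Continuous fun x => F x s
  energy : ∀ᵐ s, 0 < s → ∀ x y, x ≤ y → (v y s - v x s) ^ 2 ≤ 2 * (y - x) * (F y s - F x s)
  equation : ∀ φ : ℝ × ℝ → ℝ, ContDiff ℝ ((⊤ : ℕ∞) : WithTop ℕ∞) φ → HasCompactSupport φ →
    tsupport φ ⊆ {z : ℝ × ℝ | 0 < z.2} →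
    ∫ z in {z : ℝ × ℝ | 0 < z.2},
      (v z.1 z.2 * fderiv ℝ φ z (0, 1) + (1 / 2) * (v z.1 z.2) ^ 2 * fderiv ℝ φ z (1, 0)
        + F z.1 z.2 * φ z) = 0

/-- Cauchy-Schwarz, obtained from nonnegativity of the variance of `f` about its mean `m`. -/
theorem sq_integral_le_mul_integral_sq {f : ℝ → ℝ} {a b : ℝ} (hab : a ≤ b)
    (hf : IntervalIntegrable f volume a b) (hf2 : IntervalIntegrable (fun x => f x ^ 2) volume a b) :
    (∫ x in a..b, f x) ^ 2 ≤ (b - a) * ∫ x in a..b, f x ^ 2 := by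
  rcases hab.eq_or_lt with rfl | hlt
  · simp
  set D := ∫ x in a..b, f x with hD
  set m := D / (b - a) with hm
  have hpos : 0 < b - a := sub_pos.2 hlt
  have h0 : 0 ≤ ∫ x in a..b, (f x - m) ^ 2 :=
    intervalIntegral.integral_nonneg hab fun x _ => sq_nonneg _
  have h1 : ∫ x in a..b, (f x - m) ^ 2 = (∫ x in a..b, f x ^ 2) - 2 * m * D + m ^ 2 * (b - a) := by
    have : ∀ x, (f x - m) ^ 2 = f x ^ 2 - (2 * m) * f x + m ^ 2 := fun x => by ring
    simp_rw [this]
    rw [intervalIntegral.integral_add (hf2.sub (hf.const_mul _)) (by simp),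
      intervalIntegral.integral_sub hf2 (hf.const_mul _), intervalIntegral.integral_const_mul]
    simp [hD, mul_comm]
  have h2 : m * (b - a) = D := by rw [hm]; field_simp
  have h3 : D ^ 2 = (b - a) * (2 * m * D - m ^ 2 * (b - a)) := by rw [← h2]; ring
  rw [h3]
  exact mul_le_mul_of_nonneg_left (by linarith) hpos.le

theorem IsWeakSolution.exists_energyFlow {u₀ : ℝ → ℝ} {u : ℝ → ℝ → ℝ} (hu : IsWeakSolution u₀ u) :
    ∃ v F M, (∀ x t, 0 ≤ t → v x t = u x t) ∧ EnergyFlow v F M := by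
  obtain ⟨C, hC⟩ := hu.bounded
  -- Freezing the initial profile for negative times makes the field continuous on the whole plane.
  set v : ℝ → ℝ → ℝ := fun x s => u x (max s 0) with hv
  have hvu : ∀ x t, 0 ≤ t → v x t = u x t := fun x t ht => by simp [hv, max_eq_left ht]
  have hcont : Continuous (Function.uncurry v) := by
    have : Continuous fun z : ℝ × ℝ => ((z.1, max z.2 0) : ℝ × ℝ) := by fun_prop
    exact hu.continuousOn.comp_continuous this fun z => mem_ofPred_eq ▸ le_max_right z.2 0
  set W : ℝ → ℝ → ℝ := fun x s => deriv (fun y => v y s) x with hW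
  have hWm : Measurable (fun p : ℝ × ℝ => W p.1 p.2) := by
    have h := measurable_deriv_with_param (𝕜 := ℝ) (f := fun s x => v x s)
      (hcont.comp continuous_swap)
    exact h.comp measurable_swap
  have hWs : ∀ s, Measurable fun x => W x s := fun s =>
    hWm.comp (measurable_id.prodMk measurable_const)
  set S : ℝ → ℝ≥0∞ := fun s => ∫⁻ x, ENNReal.ofReal (W x s ^ 2) with hS
  have hSm : Measurable S := by
    refine Measurable.lintegral_prod_right' (f := fun p : ℝ × ℝ => ENNReal.ofReal (W p.2 p.1 ^ 2)) ?_
    exact ((hWm.comp measurable_swap).pow_const 2).ennreal_ofReal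
  set G : Set ℝ := {s | S s ≤ (C : ℝ≥0∞) ^ 2} with hG
  have hGm : MeasurableSet G := measurableSet_le hSm measurable_const
  have hint : ∀ s ∈ G, Integrable fun x => W x s ^ 2 := by
    intro s hs
    refine (lintegral_ofReal_ne_top_iff_integrable ((hWs s).pow_const 2).aestronglyMeasurable
      (Eventually.of_forall fun x => sq_nonneg _)).1 ?_
    exact ne_top_of_le_ne_top (by simp) hs
  have hGae : ∀ᵐ s, 0 < s → s ∈ G := by
    rw [ae_restrict_iff' measurableSet_Ici] at hC
    filter_upwards [hC] with s hs hs0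
    have h1 := hs hs0.le
    have h2 : (fun x => w u x s) = fun x => W x s := by
      funext x; simp [w, hW, hv, max_eq_left hs0.le]
    rw [h2] at h1
    have h3 : S s = eLpNorm (fun x => W x s) 2 volume ^ 2 := by
      rw [eLpNorm_eq_lintegral_rpow_enorm_toReal (by simp) (by simp), ← ENNReal.rpow_natCast,
        ← ENNReal.rpow_mul]
      simp only [ENNReal.toReal_ofNat, Nat.cast_ofNat, one_div, ne_eq, OfNat.ofNat_ne_zero,
        not_false_eq_true, inv_mul_cancel₀, ENNReal.rpow_one, hS]
      refine lintegral_congr fun x => ?_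
      rw [← ofReal_norm, ENNReal.ofReal_rpow_of_nonneg (norm_nonneg _) (by norm_num)]
      simp
    change S s ≤ _
    rw [h3]
    gcongr
  -- `G` contains almost every positive time. Setting the source to zero at the other times changes
  -- no integral over `t > 0`, and makes its bounds, monotonicity and continuity in `x` hold at
  -- every time.
  set F : ℝ → ℝ → ℝ := fun x s => G.indicator (fun s => (1 / 2) * ∫ y in Iic x, W y s ^ 2) s
    with hF
  have hFin : ∀ x, ∀ s ∈ G, F x s = (1 / 2) * ∫ y in Iic x, W y s ^ 2 := fun x s hs => by
    simp [hF, hs]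
  have hFout : ∀ x, ∀ s ∉ G, F x s = 0 := fun x s hs => by simp [hF, hs]
  have hFsub : ∀ s ∈ G, ∀ x y, F y s - F x s = (1 / 2) * ∫ z in x..y, W z s ^ 2 := by
    intro s hs x y
    rw [hFin _ _ hs, hFin _ _ hs, ← mul_sub,
      intervalIntegral.integral_Iic_sub_Iic (hint s hs).integrableOn (hint s hs).integrableOn]
  refine ⟨v, F, (1 / 2) * (C : ℝ) ^ 2, hvu, hcont, ?_, ?_, ?_, ?_, ?_, ?_, ?_⟩
  · have h1 : Measurable fun p : ℝ × ℝ => ∫ y, (Iic p.1).indicator (fun y => W y p.2 ^ 2) y := by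
      have : StronglyMeasurable fun q : (ℝ × ℝ) × ℝ =>
          (Iic q.1.1).indicator (fun y => W y q.1.2 ^ 2) q.2 := by
        refine Measurable.stronglyMeasurable ?_
        have h2 : Measurable fun q : (ℝ × ℝ) × ℝ => W q.2 q.1.2 ^ 2 :=
          (hWm.comp (measurable_snd.prodMk (measurable_snd.comp measurable_fst))).pow_const 2
        have h3 : MeasurableSet {q : (ℝ × ℝ) × ℝ | q.2 ≤ q.1.1} :=
          measurableSet_le measurable_snd (measurable_fst.comp measurable_fst)
        convert h2.indicator h3 using 1
        ext q
        simp [indicator]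
      exact this.integral_prod_right.measurable
    have h2 : Measurable fun p : ℝ × ℝ => (1 / 2 : ℝ) * ∫ y in Iic p.1, W y p.2 ^ 2 := by
      refine Measurable.const_mul ?_ _
      convert h1 using 2 with p
      rw [integral_indicator measurableSet_Iic]
    exact h2.indicator (measurable_snd hGm)
  · intro x s
    by_cases hs : s ∈ G
    · rw [hFin _ _ hs]
      have := setIntegral_nonneg (μ := volume) (measurableSet_Iic (a := x)) fun y _ =>
        sq_nonneg (W y s)
      positivity
    · rw [hFout _ _ hs]
  · intro x s
    by_cases hs : s ∈ G
    · rw [hFin _ _ hs]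
      have h1 : ∫ y in Iic x, W y s ^ 2 ≤ ∫ y, W y s ^ 2 :=
        setIntegral_le_integral (hint s hs) (Eventually.of_forall fun y => sq_nonneg _)
      have h2 : ∫ y, W y s ^ 2 ≤ (C : ℝ) ^ 2 := by
        rw [integral_eq_lintegral_of_nonneg_ae (Eventually.of_forall fun y => sq_nonneg _)
          ((hWs s).pow_const 2).aestronglyMeasurable]
        refine ENNReal.toReal_le_of_le_ofReal (by positivity) ?_
        refine le_trans hs ?_
        rw [ENNReal.ofReal_pow (by positivity), ENNReal.ofReal_coe_nnreal]
      linarith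
    · rw [hFout _ _ hs]; positivity
  · intro s x y hxy
    by_cases hs : s ∈ G
    · have h1 := hFsub s hs x y
      have h2 : 0 ≤ ∫ z in x..y, W z s ^ 2 :=
        intervalIntegral.integral_nonneg hxy fun z _ => sq_nonneg _
      show F x s ≤ F y s
      linarith
    · simp [hFout _ _ hs]
  · intro s
    by_cases hs : s ∈ G
    · have h1 : (fun x => F x s) = fun x => F 0 s + (1 / 2) * ∫ z in (0 : ℝ)..x, W z s ^ 2 := by
        funext x; rw [← hFsub s hs]; ring
      rw [h1]
      exact continuous_const.add (continuous_const.mul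
        (intervalIntegral.continuous_primitive (fun a b => (hint s hs).intervalIntegrable) 0))
    · simp only [hFout _ _ hs]; exact continuous_const
  · filter_upwards [hGae] with s hs hs0 x y hxy
    have hac : AbsolutelyContinuousOnInterval (fun z => v z s) x y := by
      have := hu.absolutelyContinuous s hs0.le x y
      simpa only [hv, max_eq_left hs0.le] using this
    have h1 := hac.integral_deriv_eq_sub
    have h2 := sq_integral_le_mul_integral_sq hxy hac.intervalIntegrable_deriv
      (hint s (hs hs0)).intervalIntegrable
    rw [h1] at h2
    rw [hFsub s (hs hs0)]
    linarith
  · intro φ h1 h2 h3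
    refine Eq.trans ?_ (hu.equation φ h1 h2 h3)
    refine setIntegral_congr_ae (measurableSet_lt measurable_const measurable_snd) ?_
    have h4 : ∀ᵐ z : ℝ × ℝ, 0 < z.2 → z.2 ∈ G := Measure.quasiMeasurePreserving_snd.ae hGae
    filter_upwards [h4] with z hz hz0
    have hz0' : 0 < z.2 := hz0
    rw [hvu _ _ hz0'.le, hFin _ _ (hz hz0)]
    simp only [source, w, hW, hv, max_eq_left hz0'.le]

/-! ### Smooth cutoffs of intervals and their limits -/

/-- A smooth approximation of the indicator function of `(a, b]`. -/
noncomputable def cutoff (a b : ℝ) (n : ℕ) (s : ℝ) : ℝ :=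
  Real.smoothTransition ((n + 1) * (s - a)) - Real.smoothTransition ((n + 1) * (s - b))

theorem contDiff_cutoff (a b : ℝ) (n : ℕ) :
    ContDiff ℝ ((⊤ : ℕ∞) : WithTop ℕ∞) (cutoff a b n) := by
  unfold cutoff
  have h := Real.smoothTransition.contDiff (n := (⊤ : ℕ∞))
  exact (h.comp (by fun_prop)).sub (h.comp (by fun_prop))

theorem cutoff_eq_zero {a b : ℝ} (hab : a ≤ b) (n : ℕ) {s : ℝ} (hs : s ∉ Icc a (b + 1)) :
    cutoff a b n s = 0 := by
  have hn : (0 : ℝ) ≤ n := n.cast_nonneg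
  unfold cutoff
  by_cases h : a ≤ s
  · have h2 : b + 1 < s := by
      by_contra h3
      exact hs ⟨h, not_lt.1 h3⟩
    rw [Real.smoothTransition.one_of_one_le (by nlinarith),
      Real.smoothTransition.one_of_one_le (by nlinarith), sub_self]
  · rw [Real.smoothTransition.zero_of_nonpos (by nlinarith),
      Real.smoothTransition.zero_of_nonpos (by nlinarith), sub_self]

theorem abs_cutoff_le (a b : ℝ) (n : ℕ) (s : ℝ) : |cutoff a b n s| ≤ 1 := by
  unfold cutoff
  have h1 := Real.smoothTransition.nonneg ((n + 1) * (s - a))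
  have h2 := Real.smoothTransition.nonneg ((n + 1) * (s - b))
  have h3 := Real.smoothTransition.le_one ((n + 1) * (s - a))
  have h4 := Real.smoothTransition.le_one ((n + 1) * (s - b))
  rw [abs_le]; constructor <;> linarith

theorem tsupport_cutoff_subset {a b : ℝ} (hab : a ≤ b) (n : ℕ) :
    tsupport (cutoff a b n) ⊆ Icc a (b + 1) :=
  closure_minimal (fun s hs => by
    by_contra h
    exact hs (cutoff_eq_zero hab n h)) isClosed_Icc

theorem hasCompactSupport_cutoff {a b : ℝ} (hab : a ≤ b) (n : ℕ) :
    HasCompactSupport (cutoff a b n) :=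
  HasCompactSupport.intro isCompact_Icc fun _ hs => cutoff_eq_zero hab n hs

theorem tendsto_smoothTransition_mul (s a : ℝ) :
    Tendsto (fun n : ℕ => Real.smoothTransition ((n + 1) * (s - a))) atTop
      (𝓝 ((Ioi a).indicator 1 s)) := by
  by_cases h : a < s
  · have h1 : Tendsto (fun n : ℕ => ((n : ℝ) + 1) * (s - a)) atTop atTop :=
      (tendsto_atTop_add_const_right _ _ tendsto_natCast_atTop_atTop).atTop_mul_const (sub_pos.2 h)
    rw [indicator_of_mem (mem_Ioi.2 h)]
    refine tendsto_const_nhds.congr' ?_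
    filter_upwards [h1.eventually_ge_atTop 1] with n hn
    exact (Real.smoothTransition.one_of_one_le hn).symm
  · rw [indicator_of_notMem (by simpa using h)]
    refine tendsto_const_nhds.congr fun n => ?_
    refine (Real.smoothTransition.zero_of_nonpos ?_).symm
    have hn : (0 : ℝ) ≤ n := n.cast_nonneg
    nlinarith

theorem tendsto_cutoff {a b : ℝ} (hab : a ≤ b) (s : ℝ) :
    Tendsto (fun n => cutoff a b n s) atTop (𝓝 ((Ioc a b).indicator 1 s)) := by
  have h := (tendsto_smoothTransition_mul s a).sub (tendsto_smoothTransition_mul s b)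
  have key : (Ioc a b).indicator (1 : ℝ → ℝ) s =
      (Ioi a).indicator 1 s - (Ioi b).indicator 1 s := by
    by_cases h1 : a < s <;> by_cases h2 : b < s
    · simp [indicator, h1, h2, not_le.2 h2]
    · simp [indicator, h1, h2, not_lt.1 h2]
    · exact absurd (hab.trans_lt h2) h1
    · simp [indicator, h1, h2]
  rw [key]
  exact h

/-- Dominated convergence. The map `π` lets the same statement serve for cutting off in space and in
time. -/
theorem tendsto_integral_mul_cutoff {X : Type*} [MeasurableSpace X] {μ : Measure X} {f : X → ℝ}
    {π : X → ℝ} (hπ : Measurable π) {a b : ℝ} (hab : a ≤ b)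
    (hf : IntegrableOn f (π ⁻¹' Icc a (b + 1)) μ) :
    Tendsto (fun n => ∫ x, f x * cutoff a b n (π x) ∂μ) atTop
      (𝓝 (∫ x in π ⁻¹' Ioc a b, f x ∂μ)) := by
  have hI : MeasurableSet (π ⁻¹' Icc a (b + 1)) := hπ measurableSet_Icc
  have h1 : ∀ n, ∫ x, f x * cutoff a b n (π x) ∂μ =
      ∫ x in π ⁻¹' Icc a (b + 1), f x * cutoff a b n (π x) ∂μ := fun n => by
    refine (setIntegral_eq_integral_of_forall_compl_eq_zero fun x hx => ?_).symm
    rw [cutoff_eq_zero hab n hx, mul_zero]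
  have h2 : ∫ x in π ⁻¹' Ioc a b, f x ∂μ =
      ∫ x in π ⁻¹' Icc a (b + 1), f x * (Ioc a b).indicator 1 (π x) ∂μ := by
    have h3 : ∀ x, f x * (Ioc a b).indicator 1 (π x) = (π ⁻¹' Ioc a b).indicator f x := fun x => by
      by_cases hx : π x ∈ Ioc a b <;> simp [indicator, hx]
    simp_rw [h3]
    rw [setIntegral_indicator (hπ measurableSet_Ioc), inter_eq_self_of_subset_right]
    exact preimage_mono fun s hs => ⟨hs.1.le, by linarith [hs.2]⟩
  simp_rw [h1]
  rw [h2]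
  refine tendsto_integral_of_dominated_convergence (fun x => |f x|) (fun n => ?_) hf.abs
    (fun n => Eventually.of_forall fun x => ?_) (Eventually.of_forall fun x => ?_)
  · exact hf.aestronglyMeasurable.mul
      ((contDiff_cutoff a b n).continuous.measurable.comp hπ).aestronglyMeasurable
  · rw [norm_mul]
    exact mul_le_of_le_one_right (abs_nonneg _) (abs_cutoff_le _ _ _ _)
  · exact (tendsto_cutoff hab (π x)).const_mul (f x)

theorem deriv_smoothTransition_eq_zero {r : ℝ} (hr : r ∉ Icc (0 : ℝ) 1) :
    deriv Real.smoothTransition r = 0 := by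
  rcases lt_or_ge r 0 with h | h
  · have : Real.smoothTransition =ᶠ[𝓝 r] fun _ => 0 := by
      filter_upwards [Iio_mem_nhds h] with x hx
      exact Real.smoothTransition.zero_of_nonpos (le_of_lt hx)
    rw [this.deriv_eq, deriv_const]
  · have h1 : 1 < r := by
      by_contra h3
      exact hr ⟨h, not_lt.1 h3⟩
    have : Real.smoothTransition =ᶠ[𝓝 r] fun _ => 1 := by
      filter_upwards [Ioi_mem_nhds h1] with x hx
      exact Real.smoothTransition.one_of_one_le (le_of_lt hx)
    rw [this.deriv_eq, deriv_const]

theorem continuous_deriv_smoothTransition : Continuous (deriv Real.smoothTransition) :=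
  (Real.smoothTransition.contDiff (n := 1)).continuous_deriv le_rfl

theorem hasDerivAt_smoothTransition_mul (c a s : ℝ) :
    HasDerivAt (fun s => Real.smoothTransition (c * (s - a)))
      (c * deriv Real.smoothTransition (c * (s - a))) s := by
  have h1 : HasDerivAt (fun s => c * (s - a)) c s := by
    simpa using ((hasDerivAt_id s).sub_const a).const_mul c
  have h2 : DifferentiableAt ℝ Real.smoothTransition (c * (s - a)) :=
    (Real.smoothTransition.contDiff (n := 1)).differentiable one_ne_zero _
  rw [mul_comm c (deriv _ _)]
  exact h2.hasDerivAt.comp s h1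

theorem integral_mul_deriv_smoothTransition (g : ℝ → ℝ) (a : ℝ) {c : ℝ} (hc : 0 < c) :
    ∫ s, g s * (c * deriv Real.smoothTransition (c * (s - a))) =
      ∫ r in (0 : ℝ)..1, g (a + c⁻¹ * r) * deriv Real.smoothTransition r := by
  have h1 : ∫ s, g s * (c * deriv Real.smoothTransition (c * (s - a))) =
      ∫ s, g (s + a) * (c * deriv Real.smoothTransition (c * s)) := by
    rw [← integral_add_right_eq_self _ a]; simp
  have h2 : ∀ s, g (s + a) * (c * deriv Real.smoothTransition (c * s)) =
      c * (fun r => g (a + c⁻¹ * r) * deriv Real.smoothTransition r) (c * s) := fun s => by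
    simp only
    rw [inv_mul_cancel_left₀ hc.ne', add_comm s a]; ring
  rw [h1]
  simp_rw [h2]
  rw [integral_const_mul,
    Measure.integral_comp_mul_left (fun r => g (a + c⁻¹ * r) * deriv Real.smoothTransition r) c,
    abs_of_pos (inv_pos.2 hc), smul_eq_mul, mul_inv_cancel_left₀ hc.ne',
    intervalIntegral.integral_of_le zero_le_one, ← integral_Icc_eq_integral_Ioc]
  refine (setIntegral_eq_integral_of_forall_compl_eq_zero fun x hx => ?_).symm
  rw [deriv_smoothTransition_eq_zero hx, mul_zero]

/-- The rescaled derivative is a one-sided approximate identity: after substitution the integral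
averages `g(a + r/(n+1))` against a density of total mass `1` on `[0, 1]`. -/
theorem tendsto_integral_mul_deriv_smoothTransition {g : ℝ → ℝ} (hg : Continuous g) (a : ℝ) :
    Tendsto (fun n : ℕ => ∫ s, g s * ((n + 1) * deriv Real.smoothTransition ((n + 1) * (s - a))))
      atTop (𝓝 (g a)) := by
  have hk : Continuous fun e : ℝ =>
      ∫ r in (0 : ℝ)..1, g (a + e * r) * deriv Real.smoothTransition r := by
    apply intervalIntegral.continuous_parametric_intervalIntegral_of_continuous'
    have := continuous_deriv_smoothTransition
    fun_prop
  have h0 : ∫ r in (0 : ℝ)..1, g (a + 0 * r) * deriv Real.smoothTransition r = g a := by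
    simp only [zero_mul, add_zero]
    rw [intervalIntegral.integral_const_mul, intervalIntegral.integral_deriv_eq_sub
      (fun x _ => (Real.smoothTransition.contDiff (n := 1)).differentiable one_ne_zero _)
      (continuous_deriv_smoothTransition.intervalIntegrable _ _)]
    simp
  have h1 : Tendsto (fun n : ℕ => ((n : ℝ) + 1)⁻¹) atTop (𝓝 0) :=
    (tendsto_atTop_add_const_right _ _ tendsto_natCast_atTop_atTop).inv_tendsto_atTop
  have h2 := (hk.tendsto 0).comp h1
  rw [h0] at h2
  refine h2.congr fun n => ?_
  rw [integral_mul_deriv_smoothTransition g a (by positivity : (0 : ℝ) < n + 1)]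
  rfl

theorem integrable_mul_deriv_smoothTransition {g : ℝ → ℝ} (hg : Continuous g) (a : ℝ) {c : ℝ}
    (hc : 0 < c) : Integrable fun s => g s * (c * deriv Real.smoothTransition (c * (s - a))) := by
  refine Continuous.integrable_of_hasCompactSupport ?_
    (HasCompactSupport.intro (isCompact_Icc (a := a) (b := a + c⁻¹)) fun s hs => ?_)
  · have := continuous_deriv_smoothTransition
    fun_prop
  · rw [deriv_smoothTransition_eq_zero, mul_zero, mul_zero]
    rintro ⟨h1, h2⟩
    refine hs ⟨by nlinarith, ?_⟩
    have : s - a ≤ c⁻¹ := by rw [← one_div, le_div_iff₀ hc]; linarith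
    linarith

theorem deriv_cutoff (a b : ℝ) (n : ℕ) (s : ℝ) :
    deriv (cutoff a b n) s = (n + 1) * deriv Real.smoothTransition ((n + 1) * (s - a)) -
      (n + 1) * deriv Real.smoothTransition ((n + 1) * (s - b)) :=
  ((hasDerivAt_smoothTransition_mul _ _ _).sub (hasDerivAt_smoothTransition_mul _ _ _)).deriv

theorem tendsto_integral_mul_deriv_cutoff {g : ℝ → ℝ} (hg : Continuous g) (a b : ℝ) :
    Tendsto (fun n => ∫ s, g s * deriv (cutoff a b n) s) atTop (𝓝 (g a - g b)) := by
  refine ((tendsto_integral_mul_deriv_smoothTransition hg a).sub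
    (tendsto_integral_mul_deriv_smoothTransition hg b)).congr fun n => ?_
  rw [← integral_sub (integrable_mul_deriv_smoothTransition hg a (by positivity))
    (integrable_mul_deriv_smoothTransition hg b (by positivity))]
  simp_rw [deriv_cutoff, mul_sub]

theorem tsupport_mul_subset_prod (α β : ℝ → ℝ) :
    tsupport (fun z : ℝ × ℝ => α z.1 * β z.2) ⊆ tsupport α ×ˢ tsupport β :=
  closure_minimal (fun z hz => by
    have := mul_ne_zero_iff.1 hz
    exact ⟨subset_tsupport α this.1, subset_tsupport β this.2⟩)
    ((isClosed_tsupport α).prod (isClosed_tsupport β))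

theorem hasCompactSupport_mul_prod {α β : ℝ → ℝ} (hα : HasCompactSupport α)
    (hβ : HasCompactSupport β) : HasCompactSupport fun z : ℝ × ℝ => α z.1 * β z.2 :=
  HasCompactSupport.of_support_subset_isCompact (hα.isCompact.prod hβ.isCompact)
    ((subset_tsupport _).trans (tsupport_mul_subset_prod α β))

/-! ### The balance law on rectangles -/

namespace EnergyFlow

variable {v F : ℝ → ℝ → ℝ} {M : ℝ}

theorem integrable_mul {f : ℝ × ℝ → ℝ} {α β : ℝ → ℝ} (hf : Continuous f)
    (hα : Continuous α) (hβ : Continuous β) (hα' : HasCompactSupport α)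
    (hβ' : HasCompactSupport β) : Integrable fun z : ℝ × ℝ => f z * (α z.1 * β z.2) :=
  Continuous.integrable_of_hasCompactSupport (by fun_prop)
    (hasCompactSupport_mul_prod hα' hβ').mul_left

/-- For a product test function the time-derivative term becomes, by Fubini, a one-dimensional
integral against `β'`, ready for letting `β` tend to an indicator. -/
theorem tensor_equation (h : EnergyFlow v F M) {α β : ℝ → ℝ}
    (hα : ContDiff ℝ ((⊤ : ℕ∞) : WithTop ℕ∞) α) (hβ : ContDiff ℝ ((⊤ : ℕ∞) : WithTop ℕ∞) β)
    (hα' : HasCompactSupport α) (hβ' : HasCompactSupport β) (hpos : tsupport β ⊆ Ioi 0) :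
    (∫ s, (∫ y, v y s * α y) * deriv β s) +
      ∫ z : ℝ × ℝ, ((1 / 2) * v z.1 z.2 ^ 2 * deriv α z.1 + F z.1 z.2 * α z.1) * β z.2 = 0 := by
  have hv := h.continuous
  have hdα : Continuous (deriv α) := hα.continuous_deriv (by simp)
  have hdβ : Continuous (deriv β) := hβ.continuous_deriv (by simp)
  have hv1 : Continuous fun z : ℝ × ℝ => v z.1 z.2 := hv
  set φ : ℝ × ℝ → ℝ := fun z => α z.1 * β z.2 with hφ
  have hsub : tsupport φ ⊆ {z : ℝ × ℝ | 0 < z.2} := fun z hz =>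
    hpos (tsupport_mul_subset_prod α β hz).2
  have heq := h.equation φ ((hα.comp contDiff_fst).mul (hβ.comp contDiff_snd))
    (hasCompactSupport_mul_prod hα' hβ') hsub
  have hder : ∀ z : ℝ × ℝ, HasFDerivAt φ
      (α z.1 • (deriv β z.2 • ContinuousLinearMap.snd ℝ ℝ ℝ) +
        β z.2 • (deriv α z.1 • ContinuousLinearMap.fst ℝ ℝ ℝ)) z := fun z => by
    have h1 : HasFDerivAt (fun z : ℝ × ℝ => α z.1) (deriv α z.1 • ContinuousLinearMap.fst ℝ ℝ ℝ) z :=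
      ((hα.differentiable (by simp)) z.1).hasDerivAt.comp_hasFDerivAt z hasFDerivAt_fst
    have h2 : HasFDerivAt (fun z : ℝ × ℝ => β z.2) (deriv β z.2 • ContinuousLinearMap.snd ℝ ℝ ℝ) z :=
      ((hβ.differentiable (by simp)) z.2).hasDerivAt.comp_hasFDerivAt z hasFDerivAt_snd
    exact h1.mul h2
  have e1 : ∀ z : ℝ × ℝ, fderiv ℝ φ z (0, 1) = α z.1 * deriv β z.2 := fun z => by
    rw [(hder z).fderiv]; simp
  have e2 : ∀ z : ℝ × ℝ, fderiv ℝ φ z (1, 0) = deriv α z.1 * β z.2 := fun z => by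
    rw [(hder z).fderiv]; simp [mul_comm]
  simp_rw [e1, e2] at heq
  have hz0 : ∀ z : ℝ × ℝ, z ∉ {z : ℝ × ℝ | 0 < z.2} → β z.2 = 0 ∧ deriv β z.2 = 0 := by
    intro z hz
    have h1 : z.2 ∉ tsupport β := fun h1 => hz (hpos h1)
    exact ⟨image_eq_zero_of_notMem_tsupport h1, image_eq_zero_of_notMem_tsupport fun h2 =>
      h1 (tsupport_deriv_subset h2)⟩
  rw [setIntegral_eq_integral_of_forall_compl_eq_zero (fun z hz => by
    simp [hφ, (hz0 z hz).1, (hz0 z hz).2])] at heq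
  have i1 : Integrable fun z : ℝ × ℝ => v z.1 z.2 * (α z.1 * deriv β z.2) :=
    integrable_mul hv1 hα.continuous hdβ hα' hβ'.deriv
  have i2 : Integrable fun z : ℝ × ℝ => (1 / 2) * v z.1 z.2 ^ 2 * (deriv α z.1 * β z.2) :=
    integrable_mul (by fun_prop) hdα hβ.continuous hα'.deriv hβ'
  have i3 : Integrable fun z : ℝ × ℝ => F z.1 z.2 * (α z.1 * β z.2) := by
    have h1 := integrable_mul (f := fun _ => 1) continuous_const hα.continuous hβ.continuous hα' hβ'
    simp only [one_mul] at h1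
    refine h1.bdd_mul (c := M) h.measurable.aestronglyMeasurable (Eventually.of_forall fun z => ?_)
    exact (abs_of_nonneg (h.nonneg z.1 z.2)).trans_le (h.le z.1 z.2)
  simp only [hφ] at heq
  have h4 : ∀ z : ℝ × ℝ, v z.1 z.2 * (α z.1 * deriv β z.2) +
      1 / 2 * v z.1 z.2 ^ 2 * (deriv α z.1 * β z.2) + F z.1 z.2 * (α z.1 * β z.2) =
      v z.1 z.2 * (α z.1 * deriv β z.2) + ((1 / 2) * v z.1 z.2 ^ 2 * (deriv α z.1 * β z.2) +
        F z.1 z.2 * (α z.1 * β z.2)) := fun z => by ring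
  simp_rw [h4] at heq
  rw [integral_add i1 (by exact i2.add i3)] at heq
  rw [← heq]
  congr 1
  · rw [Measure.volume_eq_prod, integral_prod_symm _ i1]
    refine integral_congr_ae (Eventually.of_forall fun s => ?_)
    simp only
    rw [← integral_mul_const]
    simp_rw [mul_assoc]
  · refine integral_congr_ae (Eventually.of_forall fun z => ?_)
    simp only
    ring

theorem abs_source_le (h : EnergyFlow v F M) (x s : ℝ) : |F x s| ≤ M :=
  (abs_of_nonneg (h.nonneg x s)).trans_le (h.le x s)

theorem integrableOn_strip {f : ℝ × ℝ → ℝ} {α : ℝ → ℝ} (hf : Continuous f) (hα : Continuous α)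
    (hα' : HasCompactSupport α) (c d : ℝ) :
    IntegrableOn (fun z : ℝ × ℝ => f z * α z.1) (Prod.snd ⁻¹' Icc c d) := by
  have hK : IsCompact (tsupport α ×ˢ Icc c d) := hα'.isCompact.prod isCompact_Icc
  have hK1 : IntegrableOn (fun z : ℝ × ℝ => f z * α z.1) (tsupport α ×ˢ Icc c d) :=
    ContinuousOn.integrableOn_compact hK (by fun_prop)
  refine hK1.of_forall_sdiff_eq_zero (measurable_snd measurableSet_Icc) fun z hz => ?_
  rw [image_eq_zero_of_notMem_tsupport (f := α) fun h4 => hz.2 ⟨h4, hz.1⟩, mul_zero]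

theorem integrableOn_source_mul (h : EnergyFlow v F M) {α : ℝ → ℝ} (hα : Continuous α)
    (hα' : HasCompactSupport α) (c d : ℝ) :
    IntegrableOn (fun z : ℝ × ℝ => F z.1 z.2 * α z.1) (Prod.snd ⁻¹' Icc c d) := by
  have h1 := integrableOn_strip (f := fun _ => 1) continuous_const hα hα' c d
  simp only [one_mul] at h1
  exact h1.bdd_mul (c := M) h.measurable.aestronglyMeasurable
    (Eventually.of_forall fun z => h.abs_source_le _ _)

/-- Limit of `tensor_equation` as `β` runs through cutoffs of `(t₁, t₂]`. These are supported in
`[t₁, t₂ + 1]`, so `0 < t₁` keeps the test functions inside the open half-plane. -/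
theorem integral_test_sub (h : EnergyFlow v F M) {α : ℝ → ℝ}
    (hα : ContDiff ℝ ((⊤ : ℕ∞) : WithTop ℕ∞) α) (hα' : HasCompactSupport α) {t₁ t₂ : ℝ}
    (h1 : 0 < t₁) (h2 : t₁ ≤ t₂) :
    (∫ y, v y t₁ * α y) - (∫ y, v y t₂ * α y) + ∫ z in Prod.snd ⁻¹' Ioc t₁ t₂,
      ((1 / 2) * v z.1 z.2 ^ 2 * deriv α z.1 + F z.1 z.2 * α z.1) = 0 := by
  have hv : Continuous fun z : ℝ × ℝ => v z.1 z.2 := h.continuous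
  have hdα : Continuous (deriv α) := hα.continuous_deriv (by simp)
  have hA : Continuous fun s => ∫ y, v y s * α y := by
    have : ∀ s, ∫ y, v y s * α y = ∫ y in tsupport α, v y s * α y := fun s => by
      refine (setIntegral_eq_integral_of_forall_compl_eq_zero fun y hy => ?_).symm
      rw [image_eq_zero_of_notMem_tsupport hy, mul_zero]
    simp_rw [this]
    refine continuous_parametric_integral_of_continuous ?_ hα'
    have := hα.continuous
    exact (hv.comp continuous_swap).mul (this.comp continuous_snd)
  have hint : IntegrableOn (fun z : ℝ × ℝ => (1 / 2) * v z.1 z.2 ^ 2 * deriv α z.1 +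
      F z.1 z.2 * α z.1) (Prod.snd ⁻¹' Icc t₁ (t₂ + 1)) :=
    (integrableOn_strip (by fun_prop) hdα hα'.deriv _ _).add
      (h.integrableOn_source_mul hα.continuous hα' _ _)
  have l1 := tendsto_integral_mul_deriv_cutoff hA t₁ t₂
  have l2 := tendsto_integral_mul_cutoff measurable_snd h2 hint
  refine tendsto_nhds_unique (l1.add l2) ?_
  refine tendsto_const_nhds.congr fun n => ?_
  refine (h.tensor_equation hα (contDiff_cutoff _ _ _) hα' (hasCompactSupport_cutoff h2 n) ?_).symm
  exact (tsupport_cutoff_subset h2 n).trans fun s hs => h1.trans_le hs.1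

/-- The same limit in space: the derivative of the cutoff produces the flux difference at the two
ends. -/
theorem integral_sub_add_Ioc (h : EnergyFlow v F M) {t₁ t₂ y₁ y₂ : ℝ}
    (h1 : 0 < t₁) (h2 : t₁ ≤ t₂) (hy : y₁ ≤ y₂) :
    (∫ y in Ioc y₁ y₂, v y t₁) - (∫ y in Ioc y₁ y₂, v y t₂) +
      ((∫ s in t₁..t₂, (1 / 2) * v y₁ s ^ 2) - (∫ s in t₁..t₂, (1 / 2) * v y₂ s ^ 2) +
        ∫ s in Ioc t₁ t₂, ∫ y in Ioc y₁ y₂, F y s) = 0 := by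
  have hv : Continuous fun z : ℝ × ℝ => v z.1 z.2 := h.continuous
  have hvt : ∀ t, Continuous fun y => v y t := fun t =>
    hv.comp (continuous_id.prodMk continuous_const)
  set R : Set (ℝ × ℝ) := Prod.snd ⁻¹' Ioc t₁ t₂ with hR
  have hRsub : R ⊆ Prod.snd ⁻¹' Icc t₁ t₂ := preimage_mono Ioc_subset_Icc_self
  have hRprod : R = univ ×ˢ Ioc t₁ t₂ := by ext z; simp [hR]
  have l1 : ∀ t, Tendsto (fun n => ∫ y, v y t * cutoff y₁ y₂ n y) atTop
      (𝓝 (∫ y in Ioc y₁ y₂, v y t)) := fun t =>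
    tendsto_integral_mul_cutoff measurable_id hy (hvt t).integrableOn_Icc
  have hQ : Continuous fun y => ∫ s in t₁..t₂, (1 / 2) * v y s ^ 2 := by
    apply intervalIntegral.continuous_parametric_intervalIntegral_of_continuous'
    fun_prop
  have l2 := tendsto_integral_mul_deriv_cutoff hQ y₁ y₂
  have hFint : IntegrableOn (fun z : ℝ × ℝ => F z.1 z.2) (Icc y₁ (y₂ + 1) ×ˢ Ioc t₁ t₂) := by
    refine Measure.integrableOn_of_bounded (M := M) ?_ h.measurable.aestronglyMeasurable
      (Eventually.of_forall fun z => h.abs_source_le _ _)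
    rw [Measure.volume_eq_prod, Measure.prod_prod]
    exact ENNReal.mul_ne_top (by simp) (by simp)
  have l3 := tendsto_integral_mul_cutoff (μ := volume.restrict R) (f := fun z : ℝ × ℝ => F z.1 z.2)
    measurable_fst hy (by
      rw [IntegrableOn, Measure.restrict_restrict (measurable_fst measurableSet_Icc)]
      have : Prod.fst ⁻¹' Icc y₁ (y₂ + 1) ∩ R = Icc y₁ (y₂ + 1) ×ˢ Ioc t₁ t₂ := by
        ext z; simp [hR]
      rw [this]
      exact hFint)
  have e3 : ∫ z in Prod.fst ⁻¹' Ioc y₁ y₂, F z.1 z.2 ∂(volume.restrict R) =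
      ∫ s in Ioc t₁ t₂, ∫ y in Ioc y₁ y₂, F y s := by
    rw [Measure.restrict_restrict (measurable_fst measurableSet_Ioc)]
    have : Prod.fst ⁻¹' Ioc y₁ y₂ ∩ R = Ioc y₁ y₂ ×ˢ Ioc t₁ t₂ := by
      ext z; simp [hR]
    rw [this, Measure.volume_eq_prod, ← Measure.prod_restrict, integral_prod_symm]
    rw [Measure.prod_restrict]
    exact hFint.mono_set (prod_mono (fun y hy => ⟨hy.1.le, by linarith [hy.2]⟩) Subset.rfl)
  rw [e3] at l3
  refine tendsto_nhds_unique (((l1 t₁).sub (l1 t₂)).add (l2.add l3)) ?_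
  refine tendsto_const_nhds.congr fun n => ?_
  have hc := contDiff_cutoff y₁ y₂ n
  have hc' := hasCompactSupport_cutoff hy n
  have hdc : Continuous (deriv (cutoff y₁ y₂ n)) := hc.continuous_deriv (by simp)
  rw [← h.integral_test_sub hc hc' h1 h2]
  congr 1
  have i2 : IntegrableOn (fun z : ℝ × ℝ => (1 / 2) * v z.1 z.2 ^ 2 * deriv (cutoff y₁ y₂ n) z.1) R :=
    (integrableOn_strip (by fun_prop) hdc hc'.deriv _ _).mono_set hRsub
  rw [integral_add i2 ((h.integrableOn_source_mul hc.continuous hc' _ _).mono_set hRsub)]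
  congr 1
  rw [hRprod] at i2 ⊢
  rw [Measure.volume_eq_prod, setIntegral_prod _ i2, setIntegral_univ]
  refine integral_congr_ae (Eventually.of_forall fun y => ?_)
  simp only
  rw [integral_mul_const, intervalIntegral.integral_of_le h2]

theorem intervalIntegrable_source (h : EnergyFlow v F M) {x : ℝ → ℝ} (hx : Measurable x)
    (a b : ℝ) : IntervalIntegrable (fun s => F (x s) s) volume a b := by
  rw [intervalIntegrable_iff]
  exact Measure.integrableOn_of_bounded (M := M) (by simp)
    (h.measurable.comp (hx.prodMk measurable_id)).aestronglyMeasurable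
    (Eventually.of_forall fun s => h.abs_source_le _ _)

theorem abs_integral_source_le (h : EnergyFlow v F M) (y₁ y₂ s : ℝ) :
    |∫ y in y₁..y₂, F y s| ≤ M * |y₂ - y₁| :=
  intervalIntegral.norm_integral_le_of_norm_le_const (f := fun y => F y s)
    fun _ _ => h.abs_source_le _ _

theorem measurable_integral_source (h : EnergyFlow v F M) {y₁ y₂ : ℝ → ℝ} (h1 : Measurable y₁)
    (h2 : Measurable y₂) : Measurable fun s => ∫ y in y₁ s..y₂ s, F y s := by
  have key : ∀ {a b : ℝ → ℝ}, Measurable a → Measurable b →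
      Measurable fun s => ∫ y in Ioc (a s) (b s), F y s := fun {a b} ha hb => by
    have e : ∀ s, ∫ y in Ioc (a s) (b s), F y s = ∫ y, (Ioc (a s) (b s)).indicator
        (fun y => F y s) y := fun s => (integral_indicator measurableSet_Ioc).symm
    simp_rw [e]
    have : StronglyMeasurable fun q : ℝ × ℝ =>
        (Ioc (a q.1) (b q.1)).indicator (fun y => F y q.1) q.2 := by
      refine Measurable.stronglyMeasurable ?_
      have h3 : MeasurableSet {q : ℝ × ℝ | a q.1 < q.2 ∧ q.2 ≤ b q.1} :=
        (measurableSet_lt (ha.comp measurable_fst) measurable_snd).inter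
          (measurableSet_le measurable_snd (hb.comp measurable_fst))
      convert (h.measurable.comp measurable_swap).indicator h3 using 1
      ext q
      simp [indicator, Function.uncurry]
    exact this.integral_prod_right.measurable
  exact (key h1 h2).sub (key h2 h1)

theorem intervalIntegrable_integral_source (h : EnergyFlow v F M) {y₁ y₂ : ℝ → ℝ}
    (h1 : Continuous y₁) (h2 : Continuous y₂) (a b : ℝ) :
    IntervalIntegrable (fun s => ∫ y in y₁ s..y₂ s, F y s) volume a b := by
  have hb : IntervalIntegrable (fun s => M * |y₂ s - y₁ s|) volume a b :=
    Continuous.intervalIntegrable (by fun_prop) _ _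
  exact hb.mono_fun (h.measurable_integral_source h1.measurable h2.measurable).aestronglyMeasurable
    (Eventually.of_forall fun s => (h.abs_integral_source_le _ _ _).trans (le_abs_self _))

theorem intervalIntegrable_flux (h : EnergyFlow v F M) {y₁ y₂ : ℝ → ℝ} (h1 : Continuous y₁)
    (h2 : Continuous y₂) (a b : ℝ) : IntervalIntegrable (fun s => (1 / 2) * v (y₁ s) s ^ 2 -
      (1 / 2) * v (y₂ s) s ^ 2 + ∫ y in y₁ s..y₂ s, F y s) volume a b := by
  have hv : Continuous fun z : ℝ × ℝ => v z.1 z.2 := h.continuous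
  have c1 : Continuous fun s => v (y₁ s) s := hv.comp (h1.prodMk continuous_id)
  have c2 : Continuous fun s => v (y₂ s) s := hv.comp (h2.prodMk continuous_id)
  exact (Continuous.intervalIntegrable (by fun_prop) _ _).add
    (h.intervalIntegrable_integral_source h1 h2 _ _)

theorem integral_eq_add_integral_flux (h : EnergyFlow v F M) {t : ℝ} (ht : 0 ≤ t) (y₁ y₂ : ℝ) :
    ∫ y in y₁..y₂, v y t = (∫ y in y₁..y₂, v y 0) + ∫ s in (0 : ℝ)..t,
      ((1 / 2) * v y₁ s ^ 2 - (1 / 2) * v y₂ s ^ 2 + ∫ y in y₁..y₂, F y s) := by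
  wlog hy : y₁ ≤ y₂ generalizing y₁ y₂
  · have h1 := this y₂ y₁ (le_of_not_ge hy)
    rw [intervalIntegral.integral_symm, h1, intervalIntegral.integral_symm y₁ y₂, neg_add, neg_neg]
    congr 1
    rw [← intervalIntegral.integral_neg]
    congr 1
    funext s
    rw [intervalIntegral.integral_symm y₁ y₂]
    ring
  have hv : Continuous fun z : ℝ × ℝ => v z.1 z.2 := h.continuous
  have hg := h.intervalIntegrable_flux (continuous_const (y := y₁)) (continuous_const (y := y₂))
  set g : ℝ → ℝ := fun s =>
    (1 / 2) * v y₁ s ^ 2 - (1 / 2) * v y₂ s ^ 2 + ∫ y in y₁..y₂, F y s with hgdef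
  -- The defect in the balance is constant on `(0, t]` by the rectangle identity, and continuity of
  -- `D` extends this to time `0`, which the test functions do not reach.
  set D : ℝ → ℝ := fun τ => (∫ y in y₁..y₂, v y τ) - ∫ s in (0 : ℝ)..τ, g s with hD
  have hDc : Continuous D := by
    refine Continuous.sub ?_ (intervalIntegral.continuous_primitive hg 0)
    apply intervalIntegral.continuous_parametric_intervalIntegral_of_continuous'
    exact hv.comp continuous_swap
  rcases ht.eq_or_lt with rfl | ht
  · simp
  have hDe : ∀ τ ∈ Ioo 0 t, D τ = D t := fun τ hτ => by
    have c1 : Continuous fun s => v y₁ s := hv.comp (continuous_const.prodMk continuous_id)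
    have c2 : Continuous fun s => v y₂ s := hv.comp (continuous_const.prodMk continuous_id)
    have h1 := h.integral_sub_add_Ioc hτ.1 hτ.2.le hy
    have h2 : ∫ s in τ..t, g s = (∫ s in τ..t, (1 / 2) * v y₁ s ^ 2) -
        (∫ s in τ..t, (1 / 2) * v y₂ s ^ 2) + ∫ s in Ioc τ t, ∫ y in Ioc y₁ y₂, F y s := by
      rw [hgdef, intervalIntegral.integral_add (Continuous.intervalIntegrable (by fun_prop) _ _)
        (h.intervalIntegrable_integral_source continuous_const continuous_const _ _),
        intervalIntegral.integral_sub (Continuous.intervalIntegrable (by fun_prop) _ _)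
        (Continuous.intervalIntegrable (by fun_prop) _ _),
        intervalIntegral.integral_of_le (f := fun s => ∫ y in y₁..y₂, F y s) hτ.2.le]
      simp_rw [intervalIntegral.integral_of_le hy]
    have h3 := intervalIntegral.integral_add_adjacent_intervals (hg 0 τ) (hg τ t)
    simp only [hD, intervalIntegral.integral_of_le hy]
    rw [← h3, h2]
    linarith
  have h4 : D 0 = D t := by
    have l1 : Tendsto D (𝓝[>] 0) (𝓝 (D 0)) := (hDc.tendsto 0).mono_left nhdsWithin_le_nhds
    refine tendsto_nhds_unique l1 (tendsto_const_nhds.congr' ?_)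
    filter_upwards [Ioo_mem_nhdsGT ht] with τ hτ
    exact (hDe τ hτ).symm
  simp only [hD, intervalIntegral.integral_same, sub_zero] at h4
  linarith

end EnergyFlow

/-! ### The velocity along a characteristic -/

theorem intervalIntegral_eq_sub_mul (g : ℝ → ℝ) (a b : ℝ) :
    ∫ r in a..b, g r = (b - a) * ∫ θ in (0 : ℝ)..1, g (a + (b - a) * θ) := by
  rw [intervalIntegral.mul_integral_comp_add_mul]
  simp

theorem tendsto_average_right {g : ℝ → ℝ} (hg : Continuous g) (x : ℝ) :
    Tendsto (fun n : ℕ => (n + 1) * ∫ r in x..x + ((n : ℝ) + 1)⁻¹, g r) atTop (𝓝 (g x)) := by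
  have hk : Continuous fun e : ℝ => ∫ θ in (0 : ℝ)..1, g (x + e * θ) := by
    apply intervalIntegral.continuous_parametric_intervalIntegral_of_continuous'
    fun_prop
  have h1 : Tendsto (fun n : ℕ => ((n : ℝ) + 1)⁻¹) atTop (𝓝 0) :=
    (tendsto_atTop_add_const_right _ _ tendsto_natCast_atTop_atTop).inv_tendsto_atTop
  have h2 := (hk.tendsto 0).comp h1
  simp only [zero_mul, add_zero, intervalIntegral.integral_const, sub_zero, smul_eq_mul,
    one_mul] at h2
  refine h2.congr fun n => ?_
  have hn : (0 : ℝ) < n + 1 := by positivity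
  rw [intervalIntegral_eq_sub_mul, add_sub_cancel_left, mul_inv_cancel_left₀ hn.ne']
  rfl

namespace EnergyFlow

variable {v F : ℝ → ℝ → ℝ} {M T : ℝ} {z V : ℝ → ℝ}

/-- The interval of integration has length `O(τ - t)`, and the mean of the integrand over it tends
to `0` by continuity of `g`. -/
theorem hasDerivAt_integral_moving {g : ℝ → ℝ → ℝ} (hg : Continuous (Function.uncurry g))
    (hz : Continuous z) {t : ℝ} (hz' : HasDerivWithinAt z (V t) (Ici t) t) :
    HasDerivWithinAt (fun τ => ∫ r in z t..z τ, (g r τ - g (z t) t)) 0 (Ici t) t := by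
  set k : ℝ → ℝ := fun τ => ∫ θ in (0 : ℝ)..1, (g (z t + (z τ - z t) * θ) τ - g (z t) t) with hk
  have hkc : Continuous k := by
    apply intervalIntegral.continuous_parametric_intervalIntegral_of_continuous'
    refine Continuous.sub ?_ continuous_const
    exact hg.comp (f := fun p : ℝ × ℝ => (z t + (z p.1 - z t) * p.2, p.1)) (by fun_prop)
  have hk0 : k t = 0 := by simp [hk]
  have h1 : (fun τ => z τ - z t) =O[𝓝[≥] t] fun τ => τ - t := hz'.differentiableWithinAt.isBigO_sub
  have h2 : k =o[𝓝[≥] t] fun _ => (1 : ℝ) := by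
    rw [Asymptotics.isLittleO_one_iff, ← hk0]
    exact (hkc.tendsto t).mono_left nhdsWithin_le_nhds
  rw [hasDerivWithinAt_iff_isLittleO]
  refine ((h1.mul_isLittleO h2).congr (fun τ => ?_) fun τ => mul_one _)
  rw [intervalIntegral_eq_sub_mul (fun r => g r τ - g (z t) t)]
  simp [hk]

/-- Reynolds transport for a moving right endpoint. The difference of the two sides is continuous
with vanishing right derivative, hence constant. -/
theorem integral_along (h : EnergyFlow v F M) (hz : Continuous z) (hV : Continuous V)
    (hzV : ∀ t ∈ Icc 0 T, z t = z 0 + ∫ s in (0 : ℝ)..t, V s) {t : ℝ} (ht : t ∈ Icc 0 T) :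
    (∫ r in (0 : ℝ)..z t, v r t) = (∫ r in (0 : ℝ)..z 0, v r 0) + ∫ s in (0 : ℝ)..t,
      (v (z s) s * V s + ((1 / 2) * v 0 s ^ 2 - (1 / 2) * v (z s) s ^ 2 +
        ∫ y in (0 : ℝ)..z s, F y s)) := by
  have hv : Continuous fun z : ℝ × ℝ => v z.1 z.2 := h.continuous
  have hvt : ∀ t, Continuous fun y => v y t := fun t => hv.comp (continuous_id.prodMk continuous_const)
  have hvy : ∀ y, Continuous fun t => v y t := fun t => hv.comp (continuous_const.prodMk continuous_id)
  have hvz : Continuous fun s => v (z s) s := hv.comp (hz.prodMk continuous_id)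
  set g : ℝ → ℝ := fun s => v (z s) s * V s + ((1 / 2) * v 0 s ^ 2 - (1 / 2) * v (z s) s ^ 2 +
        ∫ y in (0 : ℝ)..z s, F y s) with hgdef
  have hg : ∀ a b, IntervalIntegrable g volume a b := fun a b =>
    (Continuous.intervalIntegrable (by fun_prop) _ _).add
      (h.intervalIntegrable_flux continuous_const hz _ _)
  set f : ℝ → ℝ := fun t => (∫ r in (0 : ℝ)..z t, v r t) - ∫ s in (0 : ℝ)..t, g s with hf
  have hfc : Continuous f := by
    refine Continuous.sub ?_ (intervalIntegral.continuous_primitive hg 0)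
    exact intervalIntegral.continuous_parametric_intervalIntegral_of_continuous
      (f := fun t r => v r t) (hv.comp continuous_swap) hz
  have hder : ∀ t ∈ Ico 0 T, HasDerivWithinAt f 0 (Ici t) t := by
    intro t ht
    have hz' : HasDerivWithinAt z (V t) (Ici t) t := by
      have h1 : HasDerivAt (fun τ => z 0 + ∫ s in (0 : ℝ)..τ, V s) (V t) t :=
        (intervalIntegral.integral_hasDerivAt_right (hV.intervalIntegrable _ _)
          (hV.stronglyMeasurableAtFilter _ _) hV.continuousAt).const_add _
      refine h1.hasDerivWithinAt.congr_of_eventuallyEq ?_ (hzV t ⟨ht.1, ht.2.le⟩)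
      filter_upwards [Icc_mem_nhdsGE ht.2] with τ hτ
      exact hzV τ ⟨ht.1.trans hτ.1, hτ.2⟩
    have hA := hasDerivAt_integral_moving (V := V) h.continuous hz hz'
    -- The source need not be continuous in time, so the flux integrals cannot be differentiated one
    -- by one. In `H` the fluxes with endpoint frozen at `z t` and with moving endpoint `z s` are
    -- subtracted; only the source over the short interval from `z s` to `z t` remains, which is
    -- `O(|z t - z s|)`. Thus `H` is continuous at `t` with value `0`.
    set H : ℝ → ℝ := fun s => (v (z t) t - v (z s) s) * V s +
      ((1 / 2) * v 0 s ^ 2 - (1 / 2) * v (z t) s ^ 2 + ∫ y in (0 : ℝ)..z t, F y s) -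
      ((1 / 2) * v 0 s ^ 2 - (1 / 2) * v (z s) s ^ 2 + ∫ y in (0 : ℝ)..z s, F y s) with hH
    have hHi : ∀ a b, IntervalIntegrable H volume a b := fun a b =>
      ((Continuous.intervalIntegrable (by fun_prop) _ _).add
        (h.intervalIntegrable_flux continuous_const continuous_const _ _)).sub
        (h.intervalIntegrable_flux continuous_const hz _ _)
    have hHe : H = fun s => ((v (z t) t - v (z s) s) * V s + ((1 / 2) * v (z s) s ^ 2 -
        (1 / 2) * v (z t) s ^ 2)) + ∫ y in z s..z t, F y s := by
      funext s
      have hF : ∀ a b, IntervalIntegrable (fun y => F y s) volume a b := fun a b =>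
        (h.continuous_source s).intervalIntegrable _ _
      rw [← intervalIntegral.integral_interval_sub_left (hF 0 (z t)) (hF 0 (z s))]
      simp only [hH]
      ring
    have hH0 : H t = 0 := by simp [hHe]
    have hHc : ContinuousAt H t := by
      rw [hHe]
      refine ContinuousAt.add (Continuous.continuousAt (by fun_prop)) ?_
      rw [ContinuousAt, intervalIntegral.integral_same]
      refine squeeze_zero_norm (fun s => h.abs_integral_source_le _ _ _) ?_
      have : Continuous fun s => M * |z t - z s| := by fun_prop
      simpa using this.tendsto t
    have hB : HasDerivAt (fun τ => ∫ s in t..τ, H s) (H t) t :=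
      intervalIntegral.integral_hasDerivAt_right (hHi _ _)
        (by
          refine ⟨univ, univ_mem, ?_⟩
          rw [Measure.restrict_univ, hHe]
          exact (Continuous.aestronglyMeasurable (by fun_prop)).add
            (h.measurable_integral_source hz.measurable measurable_const).aestronglyMeasurable) hHc
    have hAB := (hA.add hB.hasDerivWithinAt).const_add (f t)
    rw [hH0, add_zero] at hAB
    have hself : f t = f t + ((fun τ => ∫ r in z t..z τ, (v r τ - v (z t) t)) +
        fun τ => ∫ s in t..τ, H s) t := by simp
    refine hAB.congr_of_eventuallyEq ?_ hself
    filter_upwards [Icc_mem_nhdsGE ht.2] with τ hτ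
    have hτ0 : 0 ≤ τ := ht.1.trans hτ.1
    have e1 : ∫ r in z t..z τ, (v r τ - v (z t) t) =
        (∫ r in (0 : ℝ)..z τ, v r τ) - (∫ r in (0 : ℝ)..z t, v r τ) - (z τ - z t) * v (z t) t := by
      rw [intervalIntegral.integral_sub ((hvt τ).intervalIntegrable _ _) (by simp),
        intervalIntegral.integral_interval_sub_left ((hvt τ).intervalIntegrable _ _)
          ((hvt τ).intervalIntegrable _ _), intervalIntegral.integral_const, smul_eq_mul]
    have e2 : z τ - z t = ∫ s in t..τ, V s := by
      rw [hzV t ⟨ht.1, ht.2.le⟩, hzV τ ⟨hτ0, hτ.2⟩, ← intervalIntegral.integral_interval_sub_left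
        (hV.intervalIntegrable 0 τ) (hV.intervalIntegrable 0 t)]
      ring
    have hGi := h.intervalIntegrable_flux (continuous_const (y := (0 : ℝ)))
      (continuous_const (y := z t))
    have e3 : (∫ r in (0 : ℝ)..z t, v r τ) - ∫ r in (0 : ℝ)..z t, v r t = ∫ s in t..τ,
        ((1 / 2) * v 0 s ^ 2 - (1 / 2) * v (z t) s ^ 2 + ∫ y in (0 : ℝ)..z t, F y s) := by
      rw [h.integral_eq_add_integral_flux hτ0, h.integral_eq_add_integral_flux ht.1,
        ← intervalIntegral.integral_interval_sub_left (hGi 0 τ) (hGi 0 t)]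
      ring
    have e4 : ∫ s in t..τ, H s = v (z t) t * (∫ s in t..τ, V s) + (∫ s in t..τ,
        ((1 / 2) * v 0 s ^ 2 - (1 / 2) * v (z t) s ^ 2 + ∫ y in (0 : ℝ)..z t, F y s)) -
        ((∫ s in (0 : ℝ)..τ, g s) - ∫ s in (0 : ℝ)..t, g s) := by
      rw [intervalIntegral.integral_interval_sub_left (hg _ _) (hg _ _),
        ← intervalIntegral.integral_const_mul,
        ← intervalIntegral.integral_add (Continuous.intervalIntegrable (by fun_prop) _ _) (hGi _ _),
        ← intervalIntegral.integral_sub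
          ((Continuous.intervalIntegrable (by fun_prop) _ _).add (hGi _ _)) (hg _ _)]
      refine intervalIntegral.integral_congr fun s _ => ?_
      simp only [hH, hgdef]
      ring
    simp only [Pi.add_apply, hf]
    rw [e1, e4, ← e3, e2]
    ring
  have hconst := constant_of_has_deriv_right_zero hfc.continuousOn hder t ht
  simp only [hf, intervalIntegral.integral_same, sub_zero] at hconst
  linarith

/-- Divide the balance in the strip between `x` and `x + e` by `e` and let `e` tend to `0`. Both
edges move with velocity `v (x s) s`, so the flux terms combine into the square of the velocity jump
across the strip. -/
theorem velocity_along (h : EnergyFlow v F M) {x : ℝ → ℝ} (hx : Continuous x)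
    (hxv : ∀ t ∈ Icc 0 T, x t = x 0 + ∫ s in (0 : ℝ)..t, v (x s) s) {t : ℝ} (ht : t ∈ Icc 0 T) :
    v (x t) t = v (x 0) 0 + ∫ s in (0 : ℝ)..t, F (x s) s := by
  have hv : Continuous fun z : ℝ × ℝ => v z.1 z.2 := h.continuous
  have hvt : ∀ t, Continuous fun y => v y t := fun t => hv.comp (continuous_id.prodMk continuous_const)
  have hvx : ∀ e, Continuous fun s => v (x s + e) s := fun e =>
    hv.comp ((hx.add continuous_const).prodMk continuous_id)
  have hvx0 : Continuous fun s => v (x s) s := by simpa using hvx 0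
  have strip : ∀ e, (∫ r in x t..x t + e, v r t) - (∫ r in x 0..x 0 + e, v r 0) =
      ∫ s in (0 : ℝ)..t, ((∫ y in x s..x s + e, F y s) - (1 / 2) * (v (x s + e) s - v (x s) s) ^ 2) := by
    intro e
    have h1 := h.integral_along hx hvx0 hxv ht
    have h2 := h.integral_along (z := fun s => x s + e) (hx.add continuous_const) hvx0
      (fun t ht => by rw [hxv t ht]; ring) ht
    have i1 : ∀ z : ℝ → ℝ, Continuous z → IntervalIntegrable (fun s => v (z s) s * v (x s) s +
        ((1 / 2) * v 0 s ^ 2 - (1 / 2) * v (z s) s ^ 2 + ∫ y in (0 : ℝ)..z s, F y s)) volume 0 t :=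
      fun z hz => by
        have : Continuous fun s => v (z s) s := hv.comp (hz.prodMk continuous_id)
        exact (Continuous.intervalIntegrable (by fun_prop) _ _).add
          (h.intervalIntegrable_flux continuous_const hz _ _)
    rw [← intervalIntegral.integral_interval_sub_left ((hvt t).intervalIntegrable 0 _)
      ((hvt t).intervalIntegrable 0 _), ← intervalIntegral.integral_interval_sub_left
      ((hvt 0).intervalIntegrable 0 _) ((hvt 0).intervalIntegrable 0 _), h1, h2]
    have e1 : ∀ a b c d : ℝ, a + b - (c + d) - (a - c) = b - d := fun a b c d => by ring
    rw [e1, ← intervalIntegral.integral_sub (i1 (fun s => x s + e) (by fun_prop)) (i1 x hx)]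
    refine intervalIntegral.integral_congr fun s _ => ?_
    have hF : ∀ a b, IntervalIntegrable (fun y => F y s) volume a b := fun a b =>
      (h.continuous_source s).intervalIntegrable _ _
    rw [← intervalIntegral.integral_interval_sub_left (hF 0 (x s + e)) (hF 0 (x s))]
    ring
  have lim1 : Tendsto (fun n : ℕ => (n + 1) * ((∫ r in x t..x t + ((n : ℝ) + 1)⁻¹, v r t) -
      ∫ r in x 0..x 0 + ((n : ℝ) + 1)⁻¹, v r 0)) atTop (𝓝 (v (x t) t - v (x 0) 0)) := by
    simp_rw [mul_sub]
    exact (tendsto_average_right (hvt t) (x t)).sub (tendsto_average_right (hvt 0) (x 0))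
  have lim2 : Tendsto (fun n : ℕ => (n + 1) * ((∫ r in x t..x t + ((n : ℝ) + 1)⁻¹, v r t) -
      ∫ r in x 0..x 0 + ((n : ℝ) + 1)⁻¹, v r 0)) atTop (𝓝 (∫ s in (0 : ℝ)..t, F (x s) s)) := by
    simp_rw [strip, ← intervalIntegral.integral_const_mul]
    have hM : 0 ≤ M := (h.nonneg 0 0).trans (h.le 0 0)
    have hinv : Tendsto (fun n : ℕ => ((n : ℝ) + 1)⁻¹) atTop (𝓝 0) :=
      (tendsto_atTop_add_const_right _ _ tendsto_natCast_atTop_atTop).inv_tendsto_atTop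
    -- The energy inequality on an interval of length `1/(n+1)` absorbs the factor `n + 1`. This
    -- bound gives both the dominating constant and the convergence of the error to `0`.
    have hsq : ∀ᵐ s, 0 < s → ∀ n : ℕ, (n + 1) * ((1 / 2) *
        (v (x s + ((n : ℝ) + 1)⁻¹) s - v (x s) s) ^ 2) ≤
        F (x s + ((n : ℝ) + 1)⁻¹) s - F (x s) s := by
      filter_upwards [h.energy] with s hs hs0 n
      have hn : (0 : ℝ) < n + 1 := by positivity
      have h1 := hs hs0 (x s) (x s + ((n : ℝ) + 1)⁻¹) (by simp [hn.le])
      rw [add_sub_cancel_left] at h1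
      calc _ ≤ ((n : ℝ) + 1) * ((1 / 2) * (2 * ((n : ℝ) + 1)⁻¹ *
            (F (x s + ((n : ℝ) + 1)⁻¹) s - F (x s) s))) := by gcongr
        _ = _ := by field_simp
    refine intervalIntegral.tendsto_integral_filter_of_dominated_convergence (fun _ => M + M)
      (Eventually.of_forall fun n => ?_) (Eventually.of_forall fun n => ?_) (by simp) ?_
    · refine Measurable.aestronglyMeasurable (Measurable.const_mul (Measurable.sub
        (h.measurable_integral_source hx.measurable (hx.measurable.add_const _)) ?_) _)
      exact Continuous.measurable (by have := hvx (((n : ℝ) + 1)⁻¹); fun_prop)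
    · filter_upwards [hsq] with s hs hs0
      rw [uIoc_of_le ht.1] at hs0
      have hn : (0 : ℝ) < n + 1 := by positivity
      have h1 := hs hs0.1 n
      have h2 : |∫ y in x s..x s + ((n : ℝ) + 1)⁻¹, F y s| ≤ M * ((n : ℝ) + 1)⁻¹ := by
        simpa [abs_of_pos hn] using h.abs_integral_source_le (x s) (x s + ((n : ℝ) + 1)⁻¹) s
      rw [mul_sub, Real.norm_eq_abs]
      refine (abs_sub _ _).trans (add_le_add ?_ ?_)
      · rw [abs_mul, abs_of_pos hn]
        calc _ ≤ ((n : ℝ) + 1) * (M * ((n : ℝ) + 1)⁻¹) := by gcongr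
          _ = M := by field_simp
      · rw [abs_of_nonneg (by positivity)]
        have := h.le (x s + ((n : ℝ) + 1)⁻¹) s
        have := h.nonneg (x s) s
        linarith
    · filter_upwards [hsq] with s hs hs0
      rw [uIoc_of_le ht.1] at hs0
      simp_rw [mul_sub]
      have l1 := tendsto_average_right (h.continuous_source s) (x s)
      have l2 : Tendsto (fun n : ℕ => F (x s + ((n : ℝ) + 1)⁻¹) s - F (x s) s) atTop (𝓝 0) := by
        have h3 : Tendsto (fun n : ℕ => x s + ((n : ℝ) + 1)⁻¹) atTop (𝓝 (x s)) := by
          simpa using hinv.const_add (x s)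
        simpa using (((h.continuous_source s).tendsto (x s)).comp h3).sub_const (F (x s) s)
      have l3 := squeeze_zero (fun n => by positivity) (hs hs0.1) l2
      simpa using l1.sub l3
  have := tendsto_nhds_unique lim1 lim2
  linarith

end EnergyFlow

/-! ### Growth of squared velocity difference over distance -/

/-- The quotient is absolutely continuous and its derivative equals `p (2 H q - p²)/H²` almost
everywhere, which is nonnegative. -/
theorem sq_div_le_sq_div {p q H : ℝ → ℝ} {t : ℝ} (ht : 0 ≤ t)
    (hq : IntervalIntegrable q volume 0 t) (hp : Continuous p)
    (hpq : ∀ s ∈ Icc 0 t, p s = p 0 + ∫ r in (0 : ℝ)..s, q r)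
    (hHp : ∀ s ∈ Icc 0 t, H s = H 0 + ∫ r in (0 : ℝ)..s, p r)
    (hH : ∀ s ∈ Icc 0 t, 0 < H s) (hp0 : ∀ s ∈ Icc 0 t, 0 ≤ p s)
    (hle : ∀ᵐ s, s ∈ Ioc 0 t → p s ^ 2 ≤ 2 * H s * q s) : p 0 ^ 2 / H 0 ≤ p t ^ 2 / H t := by
  -- The integral formulas for `p` and `H` hold only on `[0, t]`; `P` and `G` are globally defined
  -- versions, so that two-sided derivatives are available at the endpoint.
  set P : ℝ → ℝ := fun s => p 0 + ∫ r in (0 : ℝ)..s, q r with hP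
  set G : ℝ → ℝ := fun s => H 0 + ∫ r in (0 : ℝ)..s, p r with hG
  have hGd : ∀ s, HasDerivAt G (p s) s := fun s =>
    (intervalIntegral.integral_hasDerivAt_right (hp.intervalIntegrable _ _)
      (hp.stronglyMeasurableAtFilter _ _) hp.continuousAt).const_add _
  have hGC : ContDiff ℝ 1 G := by
    rw [contDiff_one_iff_deriv]
    exact ⟨fun s => (hGd s).differentiableAt, by rwa [funext fun s => (hGd s).deriv]⟩
  have hGac : AbsolutelyContinuousOnInterval (fun s => (G s)⁻¹) 0 t := by
    refine ContDiffOn.absolutelyContinuousOnInterval (hGC.contDiffOn.inv fun s hs => ?_)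
    rw [uIcc_of_le ht] at hs
    have e : G s = H s := (hHp s hs).symm
    rw [e]
    exact (hH s hs).ne'
  have hPac : AbsolutelyContinuousOnInterval P 0 t := by
    have h1 : AbsolutelyContinuousOnInterval (fun _ : ℝ => p 0) 0 t :=
      ContDiffOn.absolutelyContinuousOnInterval contDiffOn_const
    exact h1.add (hq.absolutelyContinuousOnInterval_intervalIntegral left_mem_uIcc)
  have hac := (hPac.fun_mul hPac).fun_mul hGac
  have hint := hac.integral_deriv_eq_sub
  have hnn : 0 ≤ ∫ s in (0 : ℝ)..t, deriv (fun s => P s * P s * (G s)⁻¹) s := by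
    refine intervalIntegral.integral_nonneg_of_ae_restrict ht ?_
    rw [EventuallyLE, ← restrict_Ioc_eq_restrict_Icc, ae_restrict_iff' measurableSet_Ioc]
    filter_upwards [hle, hq.ae_hasDerivAt_integral] with s h1 h2 hs
    have hs' : s ∈ Icc 0 t := Ioc_subset_Icc_self hs
    have hPd : HasDerivAt P (q s) s :=
      (h2 (by rwa [uIcc_of_le ht]) 0 left_mem_uIcc).const_add _
    have e1 : P s = p s := (hpq s hs').symm
    have e2 : G s = H s := (hHp s hs').symm
    have hH' := hH s hs'
    have hd := (hPd.mul hPd).mul ((hGd s).inv (by rw [e2]; exact hH'.ne'))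
    have hd' : deriv (fun s => P s * P s * (G s)⁻¹) s = p s * (2 * H s * q s - p s ^ 2) / H s ^ 2 := by
      refine Eq.trans hd.deriv ?_
      simp only [e1, e2, Pi.mul_apply, Pi.inv_apply]
      field_simp
      ring
    rw [hd']
    have := hp0 s hs'
    have := sub_nonneg.2 (h1 hs)
    simp only [Pi.zero_apply]
    positivity
  rw [hint] at hnn
  have e3 : P t = p t := (hpq t ⟨ht, le_rfl⟩).symm
  have e4 : G t = H t := (hHp t ⟨ht, le_rfl⟩).symm
  have e5 : P 0 = p 0 := by simp [hP]
  have e6 : G 0 = H 0 := by simp [hG]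
  rw [e3, e4, e5, e6] at hnn
  rw [div_eq_mul_inv, div_eq_mul_inv, sq, sq]
  linarith

namespace EnergyFlow

variable {v F : ℝ → ℝ → ℝ} {M T : ℝ}

theorem separation_growth (h : EnergyFlow v F M) {x₁ x₂ : ℝ → ℝ} (hx₁ : Continuous x₁)
    (hx₂ : Continuous x₂) (h₁ : ∀ t ∈ Icc 0 T, x₁ t = x₁ 0 + ∫ s in (0 : ℝ)..t, v (x₁ s) s)
    (h₂ : ∀ t ∈ Icc 0 T, x₂ t = x₂ 0 + ∫ s in (0 : ℝ)..t, v (x₂ s) s) (hlt : x₁ 0 < x₂ 0)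
    (hvlt : v (x₁ 0) 0 < v (x₂ 0) 0) {t : ℝ} (ht : t ∈ Icc 0 T) :
    x₁ t < x₂ t ∧ v (x₁ t) t < v (x₂ t) t ∧
      (v (x₂ 0) 0 - v (x₁ 0) 0) ^ 2 / (x₂ 0 - x₁ 0) ≤
        (v (x₂ t) t - v (x₁ t) t) ^ 2 / (x₂ t - x₁ t) := by
  have hv : Continuous fun z : ℝ × ℝ => v z.1 z.2 := h.continuous
  have c₁ : Continuous fun s => v (x₁ s) s := hv.comp (hx₁.prodMk continuous_id)
  have c₂ : Continuous fun s => v (x₂ s) s := hv.comp (hx₂.prodMk continuous_id)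
  set p : ℝ → ℝ := fun s => v (x₂ s) s - v (x₁ s) s with hp
  set q : ℝ → ℝ := fun s => F (x₂ s) s - F (x₁ s) s with hq
  set H : ℝ → ℝ := fun s => x₂ s - x₁ s with hH
  have hpc : Continuous p := c₂.sub c₁
  have hHc : Continuous H := hx₂.sub hx₁
  have hqi : ∀ a b, IntervalIntegrable q volume a b := fun a b =>
    (h.intervalIntegrable_source hx₂.measurable a b).sub
      (h.intervalIntegrable_source hx₁.measurable a b)
  have hpq : ∀ s ∈ Icc 0 T, p s = p 0 + ∫ r in (0 : ℝ)..s, q r := fun s hs => by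
    rw [hq, intervalIntegral.integral_sub (h.intervalIntegrable_source hx₂.measurable _ _)
      (h.intervalIntegrable_source hx₁.measurable _ _)]
    simp only [hp]
    rw [h.velocity_along hx₁ h₁ hs, h.velocity_along hx₂ h₂ hs]
    ring
  have hHp : ∀ s ∈ Icc 0 T, H s = H 0 + ∫ r in (0 : ℝ)..s, p r := fun s hs => by
    rw [hp, intervalIntegral.integral_sub (c₂.intervalIntegrable _ _) (c₁.intervalIntegrable _ _)]
    simp only [hH]
    rw [h₁ s hs, h₂ s hs]
    ring
  have hp0 : 0 < p 0 := sub_pos.2 hvlt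
  have hH0 : 0 < H 0 := sub_pos.2 hlt
  have hmono : ∀ s ∈ Icc 0 T, (∀ r ∈ Ico 0 s, 0 < H r) → p 0 ≤ p s := fun s hs hr => by
    rw [hpq s hs]
    refine le_add_of_nonneg_right ?_
    rw [intervalIntegral.integral_of_le hs.1, integral_Ioc_eq_integral_Ioo]
    refine setIntegral_nonneg measurableSet_Ioo fun r hr' => sub_nonneg.2 ?_
    exact h.mono r (sub_pos.1 (hr r ⟨hr'.1.le, hr'.2⟩)).le
  have hHpos : ∀ s ∈ Icc 0 T, 0 < H s := by
    by_contra hcon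
    push Not at hcon
    obtain ⟨s₀, hs₀, hHs₀⟩ := hcon
    -- Consider the first time at which the curves have met. Until then the source difference is
    -- nonnegative, so `p ≥ p 0 > 0` and `H` cannot have fallen below `H 0`.
    set S : Set ℝ := {s | s ∈ Icc 0 T ∧ H s ≤ 0} with hS
    have hSc : IsClosed S := isClosed_Icc.inter (isClosed_le hHc continuous_const)
    have hSb : BddBelow S := ⟨0, fun s hs => hs.1.1⟩
    have hmem : sInf S ∈ S := hSc.csInf_mem ⟨s₀, hs₀, hHs₀⟩ hSb
    have hbefore : ∀ r ∈ Ico 0 (sInf S), 0 < H r := fun r hr => by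
      by_contra hneg
      exact absurd (csInf_le hSb (⟨⟨hr.1, hr.2.le.trans hmem.1.2⟩, not_lt.1 hneg⟩ : r ∈ S))
        (not_le.2 hr.2)
    have h3 : 0 ≤ ∫ r in (0 : ℝ)..sInf S, p r := by
      refine intervalIntegral.integral_nonneg hmem.1.1 fun r hr => ?_
      exact hp0.le.trans (hmono r ⟨hr.1, hr.2.trans hmem.1.2⟩ fun r' hr' =>
        hbefore r' ⟨hr'.1, hr'.2.trans_le hr.2⟩)
    have h4 := hHp _ hmem.1
    linarith [hmem.2]
  have hpp : ∀ s ∈ Icc 0 T, p 0 ≤ p s := fun s hs => hmono s hs fun r hr =>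
    hHpos r ⟨hr.1, hr.2.le.trans hs.2⟩
  have hsub : Icc 0 t ⊆ Icc 0 T := Icc_subset_Icc_right ht.2
  refine ⟨sub_pos.1 (hHpos t ht), sub_pos.1 (hp0.trans_le (hpp t ht)),
    sq_div_le_sq_div ht.1 (hqi 0 t) hpc (fun s hs => hpq s (hsub hs)) (fun s hs => hHp s (hsub hs))
    (fun s hs => hHpos s (hsub hs)) (fun s hs => hp0.le.trans (hpp s (hsub hs))) ?_⟩
  filter_upwards [h.energy] with s hs hst
  exact hs hst.1 _ _ (sub_pos.1 (hHpos s (hsub (Ioc_subset_Icc_self hst)))).le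

end EnergyFlow

/-! ### Extremal integral curves of a Hölder-1/2 field -/

section IntegralCurves

variable {v f : ℝ → ℝ → ℝ} {K T a : ℝ}

/-- Averaging `v` over a window of width `δ` gives a Lipschitz function; the Hölder bound keeps it
within `ε` of `v`, and adding `2ε` puts it strictly above. -/
theorem exists_lipschitz_strict_majorant (hv : Continuous (Function.uncurry v)) (hK : 0 ≤ K)
    (hH : ∀ s x y, (v y s - v x s) ^ 2 ≤ K * |y - x|) {ε : ℝ} (hε : 0 < ε) :
    ∃ f : ℝ → ℝ → ℝ, ∃ L : ℝ≥0, Continuous (Function.uncurry f) ∧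
      (∀ s, LipschitzWith L fun x => f x s) ∧
      ∀ x s, v x s + ε ≤ f x s ∧ f x s ≤ v x s + 3 * ε := by
  have hv' : Continuous fun z : ℝ × ℝ => v z.1 z.2 := hv
  -- Chosen so that `K δ ≤ ε²`, that is, the oscillation of `v` over a window is at most `ε`.
  set δ : ℝ := ε ^ 2 / (K + 1) with hδ
  have hδ0 : 0 < δ := by positivity
  have hKδ : K * δ ≤ ε ^ 2 := by
    rw [hδ, mul_div_assoc', div_le_iff₀ (by positivity)]
    nlinarith [sq_nonneg ε]
  have hnear : ∀ s x, ∀ θ ∈ Icc (0 : ℝ) 1, |v (x + δ * θ) s - v x s| ≤ ε := by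
    intro s x θ hθ
    refine abs_le_of_sq_le_sq ((hH s x (x + δ * θ)).trans ?_) hε.le
    rw [add_sub_cancel_left, abs_of_nonneg (mul_nonneg hδ0.le hθ.1)]
    calc K * (δ * θ) = K * δ * θ := by ring
      _ ≤ K * δ * 1 := by gcongr; exact hθ.2
      _ ≤ ε ^ 2 := by rwa [mul_one]
  set m : ℝ → ℝ → ℝ := fun x s => ∫ θ in (0 : ℝ)..1, v (x + δ * θ) s with hm
  have hvs : ∀ s, Continuous fun x => v x s := fun s =>
    hv'.comp (continuous_id.prodMk continuous_const)
  have hmc : Continuous (Function.uncurry m) := by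
    refine intervalIntegral.continuous_parametric_intervalIntegral_of_continuous'
      (f := fun (z : ℝ × ℝ) θ => v (z.1 + δ * θ) z.2) ?_ 0 1
    exact hv'.comp (f := fun p : (ℝ × ℝ) × ℝ => (p.1.1 + δ * p.2, p.1.2)) (by fun_prop)
  have hmv : ∀ x s, |m x s - v x s| ≤ ε := by
    intro x s
    have e : m x s - v x s = ∫ θ in (0 : ℝ)..1, (v (x + δ * θ) s - v x s) := by
      rw [intervalIntegral.integral_sub
        (Continuous.intervalIntegrable (u := fun θ => v (x + δ * θ) s)
          ((hvs s).comp (by fun_prop : Continuous fun θ => x + δ * θ)) _ _) (by simp)]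
      simp [hm]
    rw [e]
    have := intervalIntegral.norm_integral_le_of_norm_le_const (a := 0) (b := 1) (C := ε)
      (f := fun θ => v (x + δ * θ) s - v x s) fun θ hθ => by
        rw [uIoc_of_le zero_le_one] at hθ
        exact hnear s x θ (Ioc_subset_Icc_self hθ)
    simpa using this
  have hmL : ∀ s, LipschitzWith (Real.toNNReal (δ⁻¹ * ε)) fun x => m x s := by
    intro s
    have e : ∀ x, m x s = δ⁻¹ * ((∫ r in (0 : ℝ)..x + δ, v r s) - ∫ r in (0 : ℝ)..x, v r s) := by
      intro x
      rw [intervalIntegral.integral_interval_sub_left ((hvs s).intervalIntegrable _ _)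
        ((hvs s).intervalIntegrable _ _), intervalIntegral_eq_sub_mul, add_sub_cancel_left,
        inv_mul_cancel_left₀ hδ0.ne']
    have hd : ∀ x, HasDerivAt (fun x => m x s) (δ⁻¹ * (v (x + δ) s - v x s)) x := by
      intro x
      rw [funext e]
      have hp : ∀ y, HasDerivAt (fun y => ∫ r in (0 : ℝ)..y, v r s) (v y s) y := fun y =>
        intervalIntegral.integral_hasDerivAt_right ((hvs s).intervalIntegrable _ _)
          ((hvs s).stronglyMeasurableAtFilter _ _) (hvs s).continuousAt
      exact (((hp (x + δ)).comp_add_const x δ).sub (hp x)).const_mul _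
    refine lipschitzWith_of_nnnorm_deriv_le (fun x => (hd x).differentiableAt) fun x => ?_
    rw [(hd x).deriv, ← NNReal.coe_le_coe, coe_nnnorm, Real.coe_toNNReal _ (by positivity),
      norm_mul, Real.norm_of_nonneg (by positivity)]
    have := hnear s x 1 (by simp)
    rw [mul_one] at this
    gcongr
    exact this
  refine ⟨fun x s => m x s + 2 * ε, Real.toNNReal (δ⁻¹ * ε), ?_, fun s => ?_, fun x s => ?_⟩
  · exact hmc.add continuous_const
  · refine LipschitzWith.of_dist_le_mul fun x y => ?_
    rw [dist_add_right]
    exact (hmL s).dist_le_mul x y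
  · have := abs_le.1 (hmv x s)
    constructor <;> linarith [this.1, this.2]

/-- Picard-Lindelöf on a ball that the curve cannot leave. The projection in the upper limit freezes
the curve outside `[0, T]`, so it is continuous on the whole line. -/
theorem exists_integral_curve (hf : Continuous (Function.uncurry f)) {C : ℝ≥0}
    (hC : ∀ s, LipschitzWith C fun x => f x s) (hT : 0 ≤ T) {R L : ℝ≥0}
    (hL : ∀ s x, |x - a| ≤ R → |f x s| ≤ L) (hLR : L * T ≤ R) :
    ∃ X : ℝ → ℝ, Continuous X ∧ (∀ t, |X t - a| ≤ R) ∧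
      ∀ t, X t = a + ∫ s in (0 : ℝ)..projIcc 0 T hT t, f (X s) s := by
  have hf' : Continuous fun z : ℝ × ℝ => f z.1 z.2 := hf
  have hpl : IsPicardLindelof (fun s x => f x s) (⟨0, le_rfl, hT⟩ : Icc 0 T) a R 0 L C := by
    refine ⟨fun t _ => (hC t).lipschitzOnWith, fun x _ =>
      (hf'.comp (continuous_const.prodMk continuous_id)).continuousOn, fun t _ x hx => ?_, ?_⟩
    · exact hL t x (by simpa [Real.dist_eq] using hx)
    · simpa [hT] using hLR
  have ha : a ∈ Metric.closedBall a ((0 : ℝ≥0) : ℝ) := Metric.mem_closedBall_self le_rfl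
  obtain ⟨α, hα⟩ := ODE.FunSpace.exists_isFixedPt_next hpl ha
  refine ⟨α.compProj, α.continuous_compProj, fun t => ?_, fun t => ?_⟩
  · have := α.compProj_mem_closedBall hpl.mul_max_le (t := t)
    simpa [Real.dist_eq] using this
  · rw [ODE.FunSpace.compProj_apply]
    nth_rw 1 [← hα]
    rw [ODE.FunSpace.next_apply, ODE.picard_apply]

theorem hasDerivWithinAt_of_integral_eq {X g : ℝ → ℝ} (hg : Continuous g)
    (hX : ∀ t ∈ Icc 0 T, X t = a + ∫ s in (0 : ℝ)..t, g s) {t : ℝ} (ht : t ∈ Ico 0 T) :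
    HasDerivWithinAt X (g t) (Ici t) t := by
  have h1 : HasDerivAt (fun τ => a + ∫ s in (0 : ℝ)..τ, g s) (g t) t :=
    (intervalIntegral.integral_hasDerivAt_right (hg.intervalIntegrable _ _)
      (hg.stronglyMeasurableAtFilter _ _) hg.continuousAt).const_add _
  refine h1.hasDerivWithinAt.congr_of_eventuallyEq ?_ (hX t ⟨ht.1, ht.2.le⟩)
  filter_upwards [Icc_mem_nhdsGE ht.2] with τ hτ
  exact hX τ ⟨ht.1.trans hτ.1, hτ.2⟩

/-- Wherever the two curves touch, `Y` has strictly smaller right derivative than `X`, so it cannot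
cross. No uniqueness for the field `v` is needed. -/
theorem integral_curve_le (hv : Continuous (Function.uncurry v)) (hf : Continuous (Function.uncurry f))
    (hlt : ∀ x s, v x s < f x s) {X Y : ℝ → ℝ} {b : ℝ} (hX : Continuous X) (hY : Continuous Y)
    (hXe : ∀ t ∈ Icc 0 T, X t = a + ∫ s in (0 : ℝ)..t, f (X s) s)
    (hYe : ∀ t ∈ Icc 0 T, Y t = b + ∫ s in (0 : ℝ)..t, v (Y s) s) (hba : b ≤ a) :
    ∀ t ∈ Icc 0 T, Y t ≤ X t := by
  intro t ht
  have h0 : (0 : ℝ) ∈ Icc 0 T := ⟨le_rfl, ht.1.trans ht.2⟩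
  refine image_le_of_deriv_right_lt_deriv_boundary' hY.continuousOn
    (fun s hs => hasDerivWithinAt_of_integral_eq (g := fun s => v (Y s) s)
      (hv.comp (hY.prodMk continuous_id)) hYe hs) ?_ hX.continuousOn
    (fun s hs => hasDerivWithinAt_of_integral_eq (g := fun s => f (X s) s)
      (hf.comp (hX.prodMk continuous_id)) hXe hs) (fun s _ hs => ?_) ht
  · rw [hXe 0 h0, hYe 0 h0]
    simpa using hba
  · rw [hs]
    exact hlt _ _

/-- Curves of strictly decreasing Lipschitz majorants decrease to a curve of `v`, and each of them
dominates every curve of `v` starting at or to the left of `a`. Allowing such starting points makes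
the maximal curve monotone in its starting point. -/
theorem exists_maximal_integral_curve_aux (hv : Continuous (Function.uncurry v)) (hK : 0 ≤ K)
    (hH : ∀ s x y, (v y s - v x s) ^ 2 ≤ K * |y - x|) {B : ℝ} (hB : ∀ s, |v a s| ≤ B) (hT : 0 ≤ T) :
    ∃ X : ℝ → ℝ, Continuous X ∧ (∀ t ∈ Icc 0 T, X t = a + ∫ s in (0 : ℝ)..t, v (X s) s) ∧
      ∀ Y : ℝ → ℝ, ∀ b ≤ a, Continuous Y →
        (∀ t ∈ Icc 0 T, Y t = b + ∫ s in (0 : ℝ)..t, v (Y s) s) → ∀ t ∈ Icc 0 T, Y t ≤ X t := by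
  have hv' : Continuous fun z : ℝ × ℝ => v z.1 z.2 := hv
  have hB0 : 0 ≤ B := (abs_nonneg _).trans (hB 0)
  -- The ratio `1/4` makes consecutive majorants strictly ordered: `v + 3 e (k+1) = v + (3/4) e k <
  -- v + e k`.
  set e : ℕ → ℝ := fun k => (1 / 4) ^ k with he
  have he0 : ∀ k, 0 < e k := fun k => by positivity
  have he1 : ∀ k, e k ≤ 1 := fun k => pow_le_one₀ (by norm_num) (by norm_num)
  choose f C hfc hfC hfv using fun k => exists_lipschitz_strict_majorant hv hK hH (he0 k)
  -- The Hölder bound allows growth `√(K R)` at distance `R`, which by the arithmetic-geometric mean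
  -- inequality is at most `R/(2(T+1)) + K(T+1)/2`. With this `R` the resulting speed bound
  -- satisfies `L (T+1) = R`, so the curves stay in the ball up to time `T`.
  set R : ℝ := 2 * (T + 1) * (B + 3) + K * (T + 1) ^ 2 with hR
  have hR0 : 0 ≤ R := by positivity
  set L : ℝ := B + (R / (2 * (T + 1)) + K * (T + 1) / 2) + 3 with hL
  have hL0 : 0 ≤ L := by positivity
  have hLR : L * T ≤ R := by
    have h1 : L * (T + 1) = R := by rw [hL, hR]; field_simp; ring
    nlinarith
  have hvL : ∀ s x, |x - a| ≤ R → |v x s| + 3 ≤ L := by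
    intro s x hx
    have h1 : |v x s - v a s| ≤ R / (2 * (T + 1)) + K * (T + 1) / 2 := by
      refine abs_le_of_sq_le_sq ((hH s a x).trans ?_) (by positivity)
      have h2 : K * |x - a| ≤ K * R := by gcongr
      have h3 : (R / (2 * (T + 1)) + K * (T + 1) / 2) ^ 2 =
          (R / (2 * (T + 1)) - K * (T + 1) / 2) ^ 2 + K * R := by field_simp; ring
      nlinarith [sq_nonneg (R / (2 * (T + 1)) - K * (T + 1) / 2)]
    have h2 : |v x s| ≤ |v a s| + |v x s - v a s| := by
      simpa using abs_add_le (v a s) (v x s - v a s)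
    linarith [hB s]
  have hfL : ∀ k s x, |x - a| ≤ R → |f k x s| ≤ L := by
    intro k s x hx
    refine le_trans ?_ (hvL s x hx)
    have h1 := hfv k x s
    have h2 := he1 k
    have h3 := he0 k
    rw [abs_le]
    constructor
    · linarith [neg_abs_le (v x s)]
    · linarith [le_abs_self (v x s)]
  choose X hXc hXR hXe using fun k => exists_integral_curve (a := a) (hfc k) (hfC k) hT
    (R := ⟨R, hR0⟩) (L := ⟨L, hL0⟩) (hfL k) hLR
  have hXe' : ∀ k, ∀ t ∈ Icc 0 T, X k t = a + ∫ s in (0 : ℝ)..t, f k (X k s) s := fun k t ht => by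
    conv_lhs => rw [hXe k t, projIcc_of_mem hT ht]
  have hanti : ∀ t, Antitone fun k => X k t := by
    intro t
    refine antitone_nat_of_succ_le fun k => ?_
    have h1 := integral_curve_le (hfc (k + 1)) (hfc k) (fun x s => by
      have h2 := (hfv (k + 1) x s).2
      have h3 := (hfv k x s).1
      have h4 : e (k + 1) = e k / 4 := by simp only [he, pow_succ]; ring
      linarith [he0 k]) (hXc k) (hXc (k + 1)) (hXe' k) (hXe' (k + 1)) le_rfl
    have h5 : ∀ k, X k t = X k (projIcc 0 T hT t) := fun k => by
      rw [hXe k t, hXe k (projIcc 0 T hT t), projIcc_val]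
    rw [h5, h5 k]
    exact h1 _ (projIcc 0 T hT t).2
  have hbdd : ∀ t, BddBelow (range fun k => X k t) := fun t =>
    ⟨a - R, by
      rintro _ ⟨k, rfl⟩
      have h1 : -R ≤ X k t - a := (abs_le.1 (hXR k t)).1
      show a - R ≤ X k t
      linarith⟩
  set Z : ℝ → ℝ := fun t => ⨅ k, X k t with hZ
  have hlim : ∀ t, Tendsto (fun k => X k t) atTop (𝓝 (Z t)) := fun t =>
    tendsto_atTop_ciInf (hanti t) (hbdd t)
  have helim : Tendsto e atTop (𝓝 0) :=
    tendsto_pow_atTop_nhds_zero_of_lt_one (by norm_num) (by norm_num)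
  have hflim : ∀ s, Tendsto (fun k => f k (X k s) s) atTop (𝓝 (v (Z s) s)) := by
    intro s
    have h1 : Tendsto (fun k => v (X k s) s) atTop (𝓝 (v (Z s) s)) :=
      ((hv'.comp (continuous_id.prodMk continuous_const)).tendsto (Z s)).comp (hlim s)
    refine tendsto_of_tendsto_of_tendsto_of_le_of_le (g := fun k => v (X k s) s + e k)
      (h := fun k => v (X k s) s + 3 * e k) ?_ ?_ (fun k => (hfv k _ s).1) fun k => (hfv k _ s).2
    · simpa using h1.add helim
    · simpa using h1.add (helim.const_mul 3)
  have hZe : ∀ t, Z t = a + ∫ s in (0 : ℝ)..projIcc 0 T hT t, v (Z s) s := by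
    intro t
    refine tendsto_nhds_unique (hlim t) ?_
    simp_rw [fun k => hXe k t]
    refine Tendsto.const_add _ ?_
    refine intervalIntegral.tendsto_integral_filter_of_dominated_convergence (fun _ => L)
      (Eventually.of_forall fun k => ?_) (Eventually.of_forall fun k => ?_) (by simp)
      (Eventually.of_forall fun s _ => hflim s)
    · exact ((hfc k).comp ((hXc k).prodMk continuous_id)).aestronglyMeasurable
    · exact Eventually.of_forall fun s _ => hfL k s _ (hXR k s)
  have hZm : Measurable Z := measurable_of_tendsto_metrizable (fun k => (hXc k).measurable)
    (tendsto_pi_nhds.2 hlim)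
  have hZi : ∀ p q, IntervalIntegrable (fun s => v (Z s) s) volume p q := by
    intro p q
    rw [intervalIntegrable_iff]
    refine Measure.integrableOn_of_bounded (M := L) (by simp)
      (hv'.measurable.comp (hZm.prodMk measurable_id)).aestronglyMeasurable
      (Eventually.of_forall fun s => ?_)
    refine le_of_tendsto (hflim s).norm (Eventually.of_forall fun k => hfL k s _ (hXR k s))
  have hZc : Continuous Z := by
    rw [funext hZe]
    exact continuous_const.add ((intervalIntegral.continuous_primitive hZi 0).comp
      (continuous_subtype_val.comp continuous_projIcc))
  refine ⟨Z, hZc, fun t ht => ?_, fun Y b hba hY hYe t ht => ?_⟩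
  · conv_lhs => rw [hZe t, projIcc_of_mem hT ht]
  · refine le_ciInf fun k => ?_
    exact integral_curve_le hv (hfc k) (fun x s => by linarith [(hfv k x s).1, he0 k]) (hXc k) hY
      (hXe' k) hYe hba t ht

theorem exists_maximal_integral_curve (hv : Continuous (Function.uncurry v)) (hK : 0 ≤ K)
    (hH : ∀ s, 0 ≤ s → ∀ x y, (v y s - v x s) ^ 2 ≤ K * |y - x|) (hT : 0 ≤ T) (a : ℝ) :
    ∃ X : ℝ → ℝ, Continuous X ∧ (∀ t ∈ Icc 0 T, X t = a + ∫ s in (0 : ℝ)..t, v (X s) s) ∧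
      ∀ Y : ℝ → ℝ, ∀ b ≤ a, Continuous Y →
        (∀ t ∈ Icc 0 T, Y t = b + ∫ s in (0 : ℝ)..t, v (Y s) s) → ∀ t ∈ Icc 0 T, Y t ≤ X t := by
  have hv' : Continuous fun z : ℝ × ℝ => v z.1 z.2 := hv
  -- Clamping time to `[0, T]` provides the Hölder bound and the bound at `a` for all times, without
  -- changing the field on `[0, T]`.
  set c : ℝ → ℝ := fun s => projIcc 0 T hT s with hc
  have hcc : Continuous c := continuous_subtype_val.comp continuous_projIcc
  obtain ⟨B, hB⟩ := (isCompact_Icc (a := (0 : ℝ)) (b := T)).exists_bound_of_continuousOn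
    (hv'.comp (continuous_const.prodMk continuous_id : Continuous fun s : ℝ => (a, s))).continuousOn
  obtain ⟨X, hXc, hXe, hXmax⟩ := exists_maximal_integral_curve_aux (v := fun x s => v x (c s))
    (a := a) (B := B) (hv'.comp (by fun_prop : Continuous fun z : ℝ × ℝ => (z.1, c z.2))) hK
    (fun s x y => hH _ (projIcc 0 T hT s).2.1 x y) (fun s => hB _ (projIcc 0 T hT s).2) hT
  have key : ∀ Y : ℝ → ℝ, ∀ t ∈ Icc 0 T,
      ∫ s in (0 : ℝ)..t, v (Y s) (c s) = ∫ s in (0 : ℝ)..t, v (Y s) s := fun Y t ht => by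
    refine intervalIntegral.integral_congr fun s hs => ?_
    rw [uIcc_of_le ht.1] at hs
    simp only [hc, projIcc_of_mem hT ⟨hs.1, hs.2.trans ht.2⟩]
  refine ⟨X, hXc, fun t ht => by rw [← key X t ht]; exact hXe t ht, fun Y b hb hY hYe => ?_⟩
  exact hXmax Y b hb hY fun t ht => by rw [key Y t ht]; exact hYe t ht

/-- The reflection `x ↦ -x` turns curves of `v` into curves of `-v(-x, s)` and reverses the order.
-/
theorem exists_minimal_integral_curve (hv : Continuous (Function.uncurry v)) (hK : 0 ≤ K)
    (hH : ∀ s, 0 ≤ s → ∀ x y, (v y s - v x s) ^ 2 ≤ K * |y - x|) (hT : 0 ≤ T) (a : ℝ) :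
    ∃ X : ℝ → ℝ, Continuous X ∧ (∀ t ∈ Icc 0 T, X t = a + ∫ s in (0 : ℝ)..t, v (X s) s) ∧
      ∀ Y : ℝ → ℝ, ∀ b, a ≤ b → Continuous Y →
        (∀ t ∈ Icc 0 T, Y t = b + ∫ s in (0 : ℝ)..t, v (Y s) s) → ∀ t ∈ Icc 0 T, X t ≤ Y t := by
  have hv' : Continuous fun z : ℝ × ℝ => v z.1 z.2 := hv
  obtain ⟨X, hXc, hXe, hXmax⟩ := exists_maximal_integral_curve (v := fun x s => -v (-x) s)
    (hv'.comp (by fun_prop : Continuous fun z : ℝ × ℝ => (-z.1, z.2))).neg hK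
    (fun s hs x y => by
      have h := hH s hs (-y) (-x)
      have e : -x - -y = y - x := by ring
      rw [e] at h
      linarith) hT (-a)
  refine ⟨fun t => -X t, hXc.neg, fun t ht => ?_, fun Y b hb hY hYe t ht => ?_⟩
  · show -X t = _
    rw [hXe t ht, intervalIntegral.integral_neg]
    ring
  · have := hXmax (fun t => -Y t) (-b) (neg_le_neg hb) hY.neg (fun t ht => by
      simp only [neg_neg]
      rw [hYe t ht, intervalIntegral.integral_neg]
      ring) t ht
    linarith

end IntegralCurves

/-! ### Positive energy and difference quotients -/

theorem tendsto_straddling_slope {f : ℝ → ℝ} {m y : ℝ} (hf : HasDerivAt f m y) {c d : ℕ → ℝ}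
    (hc : ∀ n, c n ≤ y) (hd : ∀ n, y ≤ d n) (hcd : ∀ n, c n < d n)
    (hlim : Tendsto (fun n => d n - c n) atTop (𝓝 0)) :
    Tendsto (fun n => (f (d n) - f (c n)) / (d n - c n)) atTop (𝓝 m) := by
  have hcl : Tendsto c atTop (𝓝 y) := by
    refine tendsto_of_tendsto_of_tendsto_of_le_of_le (g := fun n => y - (d n - c n))
      (h := fun _ => y) (by simpa using hlim.const_sub y) tendsto_const_nhds (fun n => ?_) hc
    linarith [hd n]
  have hdl : Tendsto d atTop (𝓝 y) := by simpa using hlim.add hcl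
  rw [Metric.tendsto_atTop']
  intro ε hε
  have h1 := (hasDerivAt_iff_isLittleO.1 hf).def (half_pos hε)
  obtain ⟨N, hN⟩ := eventually_atTop.1 ((hcl.eventually h1).and (hdl.eventually h1))
  refine ⟨N, fun n hn => ?_⟩
  obtain ⟨h2, h3⟩ := hN n hn.le
  have hpos := sub_pos.2 (hcd n)
  rw [Real.norm_eq_abs, Real.norm_eq_abs, smul_eq_mul] at h2 h3
  rw [abs_of_nonpos (sub_nonpos.2 (hc n))] at h2
  rw [abs_of_nonneg (sub_nonneg.2 (hd n))] at h3
  have h4 : |f (d n) - f (c n) - m * (d n - c n)| ≤ ε / 2 * (d n - c n) := by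
    rw [abs_le] at h2 h3 ⊢
    constructor <;> nlinarith [h2.1, h2.2, h3.1, h3.2]
  have e : (f (d n) - f (c n)) / (d n - c n) - m =
      (f (d n) - f (c n) - m * (d n - c n)) / (d n - c n) := by field_simp
  rw [Real.dist_eq, e, abs_div, abs_of_pos hpos, div_lt_iff₀ hpos]
  nlinarith

/-- The step functions formed by squared positive slopes on uniform partitions converge almost
everywhere to the integrand. Their integrals are at most `Φ a b`, cell by cell and by
superadditivity, and Fatou's lemma gives the claim. -/
theorem lintegral_sq_deriv_le_of_superadditive {f : ℝ → ℝ} {a b : ℝ} (hab : a < b)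
    (hf : ∀ᵐ y, y ∈ Icc a b → DifferentiableAt ℝ f y) {Φ : ℝ → ℝ → ℝ≥0∞}
    (hΦ : ∀ c d, a ≤ c → c < d → d ≤ b → f c < f d →
      ENNReal.ofReal ((f d - f c) ^ 2 / (d - c)) ≤ Φ c d)
    (hadd : ∀ c d e, a ≤ c → c ≤ d → d ≤ e → e ≤ b → Φ c d + Φ d e ≤ Φ c e) :
    ∫⁻ y in Icc a b, ENNReal.ofReal ((max (deriv f y) 0) ^ 2) ≤ Φ a b := by
  set δ : ℕ → ℝ := fun n => (b - a) / (n + 1) with hδ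
  have hδ0 : ∀ n, 0 < δ n := fun n => div_pos (sub_pos.2 hab) (by positivity)
  set node : ℕ → ℕ → ℝ := fun n k => a + k * δ n with hnode
  have hnode0 : ∀ n, node n 0 = a := fun n => by simp [hnode]
  have hnodeS : ∀ n k, node n (k + 1) = node n k + δ n := fun n k => by
    simp only [hnode]; push_cast; ring
  have hnodeE : ∀ n, node n (n + 1) = b := fun n => by
    simp only [hnode, hδ]; push_cast; field_simp; ring
  have hnodeM : ∀ n, Monotone (node n) := fun n => monotone_nat_of_le_succ fun k => by
    rw [hnodeS]; linarith [hδ0 n]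
  -- The floor selects the half-open cell containing `y`; the step function is then measurable as a
  -- function of a natural number.
  set g : ℕ → ℝ → ℝ≥0∞ := fun n y => (fun k : ℕ =>
    ENNReal.ofReal ((max ((f (node n (k + 1)) - f (node n k)) / δ n) 0) ^ 2)) ⌊(y - a) / δ n⌋₊ with hg
  have hgm : ∀ n, Measurable (g n) := fun n => by
    refine Measurable.comp (g := fun k : ℕ =>
      ENNReal.ofReal ((max ((f (node n (k + 1)) - f (node n k)) / δ n) 0) ^ 2))
      (f := fun y => ⌊(y - a) / δ n⌋₊) measurable_from_nat ?_
    exact Nat.measurable_floor.comp ((measurable_id.sub_const a).div_const _)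
  have hfloor : ∀ n k y, y ∈ Ico (node n k) (node n (k + 1)) → ⌊(y - a) / δ n⌋₊ = k := by
    intro n k y hy
    rw [Nat.floor_eq_iff (div_nonneg ?_ (hδ0 n).le), le_div_iff₀ (hδ0 n), div_lt_iff₀ (hδ0 n)]
    · simp only [hnode] at hy
      push_cast at hy
      constructor <;> linarith [hy.1, hy.2]
    · have := hnodeM n (Nat.zero_le k)
      rw [hnode0] at this
      linarith [hy.1]
  have hpart : ∀ n k, k ≤ n + 1 → ∫⁻ y in Ico a (node n k), g n y ≤ Φ a (node n k) := by
    intro n k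
    induction k with
    | zero => intro _; simp [hnode0]
    | succ k ih =>
      intro hk
      have h1 : a ≤ node n k := by simpa [hnode0] using hnodeM n (Nat.zero_le k)
      have h2 : node n (k + 1) ≤ b := by simpa [hnodeE] using hnodeM n hk
      have h3 : node n k < node n (k + 1) := by rw [hnodeS]; linarith [hδ0 n]
      have h4 : ∫⁻ y in Ico (node n k) (node n (k + 1)), g n y ≤ Φ (node n k) (node n (k + 1)) := by
        rw [setLIntegral_congr_fun (g := fun _ =>
          ENNReal.ofReal ((max ((f (node n (k + 1)) - f (node n k)) / δ n) 0) ^ 2)) measurableSet_Ico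
          (fun y hy => by simp only [hg, hfloor n k y hy]), setLIntegral_const, Real.volume_Ico,
          ← ENNReal.ofReal_mul (by positivity)]
        have h5 : node n (k + 1) - node n k = δ n := by rw [hnodeS]; ring
        rw [h5]
        -- A cell on which `f` does not increase contributes nothing, so `hΦ` is needed only for
        -- increasing cells.
        rcases lt_or_ge (f (node n k)) (f (node n (k + 1))) with h6 | h6
        · refine le_trans (ENNReal.ofReal_le_ofReal (le_of_eq ?_)) (hΦ _ _ h1 h3 h2 h6)
          rw [max_eq_left (div_nonneg (sub_nonneg.2 h6.le) (hδ0 n).le), h5]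
          have := (hδ0 n).ne'
          field_simp
        · rw [max_eq_right (div_nonpos_of_nonpos_of_nonneg (sub_nonpos.2 h6) (hδ0 n).le)]
          simp
      rw [← Ico_union_Ico_eq_Ico h1 h3.le]
      exact (lintegral_union_le _ _ _).trans
        ((add_le_add (ih (by omega)) h4).trans (hadd _ _ _ le_rfl h1 h3.le h2))
  have hbound : ∀ n, ∫⁻ y in Ico a b, g n y ≤ Φ a b := fun n => by
    have := hpart n (n + 1) le_rfl
    rwa [hnodeE] at this
  have hlim : ∀ᵐ y ∂(volume.restrict (Ico a b)), liminf (fun n => g n y) atTop =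
      ENNReal.ofReal ((max (deriv f y) 0) ^ 2) := by
    rw [ae_restrict_iff' measurableSet_Ico]
    filter_upwards [hf] with y hy hyI
    have hd := (hy (Ico_subset_Icc_self hyI)).hasDerivAt
    have hq : ∀ n, 0 ≤ (y - a) / δ n := fun n => div_nonneg (sub_nonneg.2 hyI.1) (hδ0 n).le
    have hδlim : Tendsto δ atTop (𝓝 0) :=
      tendsto_const_nhds.div_atTop
        (tendsto_atTop_add_const_right _ _ tendsto_natCast_atTop_atTop)
    have hsub : ∀ n, node n (⌊(y - a) / δ n⌋₊ + 1) - node n ⌊(y - a) / δ n⌋₊ = δ n := fun n => by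
      rw [hnodeS]; ring
    have hs := tendsto_straddling_slope hd (c := fun n => node n ⌊(y - a) / δ n⌋₊)
      (d := fun n => node n (⌊(y - a) / δ n⌋₊ + 1))
      (fun n => by
        have := (le_div_iff₀ (hδ0 n)).1 (Nat.floor_le (hq n))
        simp only [hnode]; linarith)
      (fun n => by
        have := (div_lt_iff₀ (hδ0 n)).1 (Nat.lt_floor_add_one ((y - a) / δ n))
        simp only [hnode]; push_cast; linarith)
      (fun n => by rw [hnodeS]; linarith [hδ0 n])
      (by simp_rw [hsub]; exact hδlim)
    simp_rw [hsub] at hs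
    have hcont : Continuous fun r : ℝ => ENNReal.ofReal ((max r 0) ^ 2) :=
      ENNReal.continuous_ofReal.comp (by fun_prop)
    exact ((hcont.tendsto _).comp hs).liminf_eq
  calc ∫⁻ y in Icc a b, ENNReal.ofReal ((max (deriv f y) 0) ^ 2)
      = ∫⁻ y in Ico a b, ENNReal.ofReal ((max (deriv f y) 0) ^ 2) := by
        rw [restrict_Ico_eq_restrict_Icc]
    _ = ∫⁻ y in Ico a b, liminf (fun n => g n y) atTop := (lintegral_congr_ae hlim).symm
    _ ≤ liminf (fun n => ∫⁻ y in Ico a b, g n y) atTop := lintegral_liminf_le hgm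
    _ ≤ Φ a b := (liminf_le_liminf (Eventually.of_forall hbound)).trans (by simp)

/-- The increment of `f` is at most the integral of the positive part of `f'`; since the increment
is positive, it may be squared and Cauchy-Schwarz applied. An infinite right-hand side is trivial.
-/
theorem ofReal_sq_sub_div_le_lintegral {f : ℝ → ℝ} {a b : ℝ} (hab : a < b) (hfab : f a < f b)
    (hf : AbsolutelyContinuousOnInterval f a b) :
    ENNReal.ofReal ((f b - f a) ^ 2 / (b - a)) ≤
      ∫⁻ y in Icc a b, ENNReal.ofReal ((max (deriv f y) 0) ^ 2) := by
  rw [← restrict_Ioc_eq_restrict_Icc]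
  by_cases htop : ∫⁻ y in Ioc a b, ENNReal.ofReal ((max (deriv f y) 0) ^ 2) = ⊤
  · rw [htop]; exact le_top
  have hm : Measurable fun y => max (deriv f y) 0 := (measurable_deriv f).max measurable_const
  have h2 : IntervalIntegrable (fun y => (max (deriv f y) 0) ^ 2) volume a b := by
    rw [intervalIntegrable_iff_integrableOn_Ioc_of_le hab.le]
    exact (lintegral_ofReal_ne_top_iff_integrable (hm.pow_const 2).aestronglyMeasurable
      (Eventually.of_forall fun x => sq_nonneg _)).1 htop
  have h1 : IntervalIntegrable (fun y => max (deriv f y) 0) volume a b := by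
    have h := hf.intervalIntegrable_deriv
    rw [intervalIntegrable_iff] at h ⊢
    exact Integrable.pos_part h
  have h3 := sq_integral_le_mul_integral_sq hab.le h1 h2
  have h4 : f b - f a ≤ ∫ y in a..b, max (deriv f y) 0 := by
    rw [← hf.integral_deriv_eq_sub]
    exact intervalIntegral.integral_mono_on hab.le hf.intervalIntegrable_deriv h1
      fun y _ => le_max_left _ _
  rw [intervalIntegral.integral_of_le (f := fun y => (max (deriv f y) 0) ^ 2) hab.le] at h3
  rw [← ofReal_integral_eq_lintegral_ofReal
    ((intervalIntegrable_iff_integrableOn_Ioc_of_le hab.le).1 h2)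
    (Eventually.of_forall fun x => sq_nonneg _)]
  refine ENNReal.ofReal_le_ofReal ?_
  rw [div_le_iff₀ (sub_pos.2 hab), mul_comm]
  refine le_trans ?_ h3
  exact pow_le_pow_left₀ (sub_pos.2 hfab).le h4 2

/-! ### The Hölder bound at all times, and characteristics as integral curves -/

namespace EnergyFlow

variable {v F : ℝ → ℝ → ℝ} {M : ℝ}

/-- The energy inequality bounds the increment for almost every positive time. Such times are dense
in `[0, ∞)`, and continuity of `v` in time gives the bound at every `s ≥ 0`. -/
theorem sq_sub_le (h : EnergyFlow v F M) {s : ℝ} (hs : 0 ≤ s) (x y : ℝ) :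
    (v y s - v x s) ^ 2 ≤ 2 * M * |y - x| := by
  wlog hxy : x ≤ y generalizing x y
  · rw [abs_sub_comm, ← neg_sub, neg_sq]
    exact this y x (le_of_not_ge hxy)
  have hv : Continuous fun z : ℝ × ℝ => v z.1 z.2 := h.continuous
  have hvy : ∀ y, Continuous fun t => v y t := fun t => hv.comp (continuous_const.prodMk continuous_id)
  by_contra hcon
  rw [not_le] at hcon
  have hopen : IsOpen {r | 2 * M * |y - x| < (v y r - v x r) ^ 2} :=
    isOpen_lt continuous_const (((hvy y).sub (hvy x)).pow 2)
  have hne : ({r | 2 * M * |y - x| < (v y r - v x r) ^ 2} ∩ Ioi 0).Nonempty := by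
    have : s ∈ closure (Ioi (0 : ℝ)) := by rw [closure_Ioi]; exact hs
    exact mem_closure_iff.1 this _ hopen hcon
  obtain ⟨r, hr, hr'⟩ := (Measure.dense_of_ae h.energy).inter_open_nonempty _
    (hopen.inter isOpen_Ioi) hne
  have h1 := hr' hr.2 x y hxy
  have h2 : F y r - F x r ≤ M := by linarith [h.le y r, h.nonneg x r]
  have h3 : 2 * M * |y - x| < (v y r - v x r) ^ 2 := hr.1
  rw [abs_of_nonneg (sub_nonneg.2 hxy)] at h3
  nlinarith [sub_nonneg.2 hxy]

end EnergyFlow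

section Characteristics

variable {u v : ℝ → ℝ → ℝ} {T a : ℝ} {x X : ℝ → ℝ}

theorem IsCharacteristic.exists_integral_curve
    (huv : ∀ x t, 0 ≤ t → v x t = u x t) (hT : 0 ≤ T) (hx : IsCharacteristic u T a x) :
    ∃ X : ℝ → ℝ, Continuous X ∧ EqOn X x (Icc 0 T) ∧
      ∀ t ∈ Icc 0 T, X t = a + ∫ s in (0 : ℝ)..t, v (X s) s := by
  obtain ⟨K, hK⟩ := hx.lipschitz
  -- A characteristic is prescribed only on `[0, T]`; its constant extension is continuous on the
  -- line.
  refine ⟨IccExtend hT ((Icc 0 T).domRestrict x), hK.continuousOn.domRestrict.Icc_extend',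
    fun t ht => by rw [IccExtend_of_mem hT _ ht, domRestrict_apply], fun t ht => ?_⟩
  have hac : AbsolutelyContinuousOnInterval x 0 t := by
    refine (hK.mono ?_).absolutelyContinuousOnInterval
    rw [uIcc_of_le ht.1]
    exact Icc_subset_Icc_right ht.2
  have h1 := hac.integral_deriv_eq_sub
  rw [hx.initial] at h1
  have h2 : ∫ s in (0 : ℝ)..t, deriv x s =
      ∫ s in (0 : ℝ)..t, v (IccExtend hT ((Icc 0 T).domRestrict x) s) s := by
    refine intervalIntegral.integral_congr_ae ?_
    filter_upwards [(ae_restrict_iff' measurableSet_Icc).1 hx.hasDerivAt] with s hs hst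
    rw [uIoc_of_le ht.1] at hst
    have hsT : s ∈ Icc 0 T := ⟨hst.1.le, hst.2.trans ht.2⟩
    rw [(hs hsT).deriv, IccExtend_of_mem hT _ hsT, domRestrict_apply, huv _ _ hsT.1]
  rw [IccExtend_of_mem hT _ ht, domRestrict_apply, ← h2, h1]
  ring

theorem isCharacteristic_of_integral_curve (hv : Continuous (Function.uncurry v))
    (huv : ∀ x t, 0 ≤ t → v x t = u x t) (hT : 0 ≤ T) (hX : Continuous X)
    (hXe : ∀ t ∈ Icc 0 T, X t = a + ∫ s in (0 : ℝ)..t, v (X s) s) : IsCharacteristic u T a X := by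
  have hg : Continuous fun s => v (X s) s := hv.comp (hX.prodMk continuous_id)
  refine ⟨by rw [hXe 0 ⟨le_rfl, hT⟩]; simp, ?_, ?_⟩
  · obtain ⟨B, hB⟩ := (isCompact_Icc (a := (0 : ℝ)) (b := T)).exists_bound_of_continuousOn
      hg.continuousOn
    refine ⟨Real.toNNReal B, LipschitzOnWith.of_dist_le_mul fun s hs t ht => ?_⟩
    have e : X s - X t = ∫ r in t..s, v (X r) r := by
      rw [hXe s hs, hXe t ht, ← intervalIntegral.integral_interval_sub_left
        (hg.intervalIntegrable 0 s) (hg.intervalIntegrable 0 t)]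
      ring
    rw [Real.dist_eq, Real.dist_eq, e]
    refine intervalIntegral.norm_integral_le_of_norm_le_const (f := fun r => v (X r) r)
      fun r hr => (hB r ?_).trans (Real.le_coe_toNNReal B)
    exact (convex_Icc (0 : ℝ) T).ordConnected.uIcc_subset ht hs (uIoc_subset_uIcc hr)
  · rw [ae_restrict_iff' measurableSet_Icc]
    -- The integral formula holds only on `[0, T]`, so a two-sided derivative is obtained at
    -- interior times; the two endpoints form a null set.
    have h0 : ∀ᵐ s : ℝ, s ≠ 0 := by simp [ae_iff, measure_singleton]
    have h1 : ∀ᵐ s : ℝ, s ≠ T := by simp [ae_iff, measure_singleton]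
    filter_upwards [h0, h1] with s hs0 hsT hs
    have hlt : 0 < s := lt_of_le_of_ne hs.1 (Ne.symm hs0)
    have h2 : HasDerivAt (fun τ => a + ∫ s in (0 : ℝ)..τ, v (X s) s) (v (X s) s) s :=
      (intervalIntegral.integral_hasDerivAt_right (hg.intervalIntegrable _ _)
        (hg.stronglyMeasurableAtFilter _ _) hg.continuousAt).const_add _
    rw [← huv _ _ hs.1]
    refine h2.congr_of_eventuallyEq ?_
    filter_upwards [Icc_mem_nhds hlt (lt_of_le_of_ne hs.2 hsT)] with τ hτ
    exact hXe τ hτ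

end Characteristics

/-! ### The energy inequality between extremal characteristics -/

/-- The two intervals meet in at most one point and lie in the large one. Either may be empty, so
the inequalities `q ≤ s'` and `p' ≤ r` do not follow from the others. -/
theorem positiveEnergy_add_le (u : ℝ → ℝ → ℝ) (t : ℝ) {p q r s p' s' : ℝ} (h1 : p' ≤ p) (h2 : q ≤ r)
    (h3 : q ≤ s') (h4 : p' ≤ r) (h5 : s ≤ s') :
    positiveEnergy u p q t + positiveEnergy u r s t ≤ positiveEnergy u p' s' t := by
  unfold positiveEnergy
  rw [← restrict_Ioc_eq_restrict_Icc (a := r), ← lintegral_union measurableSet_Ioc ?_]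
  · refine lintegral_mono_set (union_subset (Icc_subset_Icc h1 h3) ?_)
    exact Ioc_subset_Icc_self.trans (Icc_subset_Icc h4 h5)
  · rw [Set.disjoint_left]
    intro y hy hy'
    exact absurd (hy.2.trans h2) (not_le.2 hy'.1)

/-- From each point there start a rightmost and a leftmost characteristic, and the energy of the
positive part of the slope between a rightmost characteristic and a leftmost characteristic starting
to its right does not fall below its initial value. -/
theorem IsWeakSolution.exists_extremal_characteristics {u₀ : ℝ → ℝ} {u : ℝ → ℝ → ℝ}
    (hu : IsWeakSolution u₀ u) {t : ℝ} (ht : 0 ≤ t) :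
    ∃ xr xl : ℝ → ℝ → ℝ, (∀ c, IsRightmostCharacteristic u t c (xr c)) ∧
      (∀ c, IsLeftmostCharacteristic u t c (xl c)) ∧
      ∀ a b, a < b → positiveEnergy u a b 0 ≤ positiveEnergy u (xr a t) (xl b t) t := by
  obtain ⟨v, F, M, huv, h⟩ := hu.exists_energyFlow
  have hM : 0 ≤ 2 * M := mul_nonneg zero_le_two ((h.nonneg 0 0).trans (h.le 0 0))
  choose xr hrc hre hrmax using
    exists_maximal_integral_curve h.continuous hM (fun s hs x y => h.sq_sub_le hs x y) ht
  choose xl hlc hle hlmin using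
    exists_minimal_integral_curve h.continuous hM (fun s hs x y => h.sq_sub_le hs x y) ht
  have ht' : t ∈ Icc 0 t := ⟨ht, le_rfl⟩
  have h0 : (0 : ℝ) ∈ Icc 0 t := ⟨le_rfl, ht⟩
  have hr0 : ∀ c, xr c 0 = c := fun c => by rw [hre c 0 h0]; simp
  have hl0 : ∀ c, xl c 0 = c := fun c => by rw [hle c 0 h0]; simp
  refine ⟨xr, xl, fun c => ⟨isCharacteristic_of_integral_curve h.continuous huv ht (hrc c) (hre c),
    fun y hy s hs => ?_⟩, fun c => ⟨isCharacteristic_of_integral_curve h.continuous huv ht (hlc c)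
    (hle c), fun y hy s hs => ?_⟩, fun a b hab => ?_⟩
  · obtain ⟨Y, hYc, hYy, hYe⟩ := hy.exists_integral_curve huv ht
    rw [← hYy hs]
    exact hrmax c Y c le_rfl hYc hYe s hs
  · obtain ⟨Y, hYc, hYy, hYe⟩ := hy.exists_integral_curve huv ht
    rw [← hYy hs]
    exact hlmin c Y c le_rfl hYc hYe s hs
  have hrr : ∀ c d, c ≤ d → xr c t ≤ xr d t := fun c d hcd =>
    hrmax d _ c hcd (hrc c) (hre c) t ht'
  have hll : ∀ c d, c ≤ d → xl c t ≤ xl d t := fun c d hcd =>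
    hlmin c _ d hcd (hlc d) (hle d) t ht'
  have hlr : ∀ c, xl c t ≤ xr c t := fun c => hrmax c _ c le_rfl (hlc c) (hle c) t ht'
  -- Superadditivity holds because at an intermediate point `d` the leftmost curve lies weakly to
  -- the left of the rightmost one, and both families are monotone in the starting point.
  refine lintegral_sq_deriv_le_of_superadditive (f := fun y => u y 0)
    (Φ := fun c d => positiveEnergy u (xr c t) (xl d t) t) hab ?_ (fun c d _ hcd _ hfcd => ?_)
    (fun c d e _ hcd hde _ => positiveEnergy_add_le u t le_rfl (hlr d) (hll d e hde) (hrr c d hcd)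
      le_rfl)
  · have := (hu.absolutelyContinuous 0 le_rfl a b).ae_differentiableAt
    rwa [uIcc_of_le hab.le] at this
  · have hgrow := h.separation_growth (T := t) (hrc c) (hlc d)
      (fun s hs => by rw [hr0]; exact hre c s hs) (fun s hs => by rw [hl0]; exact hle d s hs)
      (by rwa [hr0, hl0]) (by rw [hr0, hl0, huv _ _ le_rfl, huv _ _ le_rfl]; exact hfcd) ht'
    rw [hr0, hl0, huv _ _ le_rfl, huv _ _ le_rfl, huv _ _ ht, huv _ _ ht] at hgrow
    exact (ENNReal.ofReal_le_ofReal hgrow.2.2).trans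
      (ofReal_sq_sub_div_le_lintegral (f := fun y => u y t) hgrow.1 hgrow.2.1
        (hu.absolutelyContinuous t ht _ _))

end HunterSaxton

theorem mainTheorem6 (u₀ : ℝ → ℝ) (u : ℝ → ℝ → ℝ) (hu : HunterSaxton.IsWeakSolution u₀ u) :
    (∀ a ∈ HunterSaxton.IInftyUnique u₀ u, ∀ b ∈ HunterSaxton.IInftyUnique u₀ u, a < b →
      ∀ t : ℝ, 0 ≤ t →
        (∃ xa : ℝ → ℝ, HunterSaxton.IsCharacteristic u t a xa) ∧
        (∃ xb : ℝ → ℝ, HunterSaxton.IsCharacteristic u t b xb) ∧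
        ∀ xa xb : ℝ → ℝ, HunterSaxton.IsCharacteristic u t a xa →
          HunterSaxton.IsCharacteristic u t b xb →
          HunterSaxton.positiveEnergy u a b 0 ≤
            HunterSaxton.positiveEnergy u (xa t) (xb t) t) ∧
    (∀ a b : ℝ, a < b → ∀ t : ℝ, 0 ≤ t →
        (∃ xr : ℝ → ℝ, HunterSaxton.IsRightmostCharacteristic u t a xr) ∧
        (∃ xl : ℝ → ℝ, HunterSaxton.IsLeftmostCharacteristic u t b xl) ∧
        ∀ xr xl : ℝ → ℝ, HunterSaxton.IsRightmostCharacteristic u t a xr →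
          HunterSaxton.IsLeftmostCharacteristic u t b xl →
          HunterSaxton.positiveEnergy u a b 0 ≤
            HunterSaxton.positiveEnergy u (xr t) (xl t) t) := by
  refine ⟨fun a ha b hb hab t ht => ?_, fun a b hab t ht => ?_⟩
  · obtain ⟨xr, xl, hr, hl, hE⟩ := hu.exists_extremal_characteristics ht
    refine ⟨⟨xr a, (hr a).1⟩, ⟨xl b, (hl b).1⟩, fun xa xb hxa hxb => ?_⟩
    -- Uniqueness identifies the characteristic from `a` with the rightmost one and that from `b`
    -- with the leftmost one.
    rw [ha.2 t ht xa (xr a) hxa (hr a).1 ⟨ht, le_rfl⟩,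
      hb.2 t ht xb (xl b) hxb (hl b).1 ⟨ht, le_rfl⟩]
    exact hE a b hab
  · obtain ⟨xr, xl, hr, hl, hE⟩ := hu.exists_extremal_characteristics ht
    refine ⟨⟨xr a, hr a⟩, ⟨xl b, hl b⟩, fun xr' xl' hr' hl' => ?_⟩
    have e1 : xr' t = xr a t := le_antisymm ((hr a).2 xr' hr'.1 t ⟨ht, le_rfl⟩)
      (hr'.2 (xr a) (hr a).1 t ⟨ht, le_rfl⟩)
    have e2 : xl' t = xl b t := le_antisymm (hl'.2 (xl b) (hl b).1 t ⟨ht, le_rfl⟩)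
      ((hl b).2 xl' hl'.1 t ⟨ht, le_rfl⟩)
    rw [e1, e2]
    exact hE a b hab
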